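/- **Setting.** Let $d_X,d_Y\in\{1,2,\dots\}$, $d:=d_X+d_Y$, $s_X,s_Y>0$, $s:=d/(d_X/s_X+d_Y/s_Y)$, $A>1$, $r>0$. Let $\mathcal X=[0,1]^{d_X}$ and $\mathcal Y=[0,1]^{d_Y}$ carry Lebesgue measures $\mu_X,\mu_Y$, and let $\mu=\mu_X\otimes\mu_Y$. For $M_X\subseteq\mathbb Z^{d_X}$ with $0\in M_X$ put $\mathcal J=\{(a,m):a\in\{0,1\},m\in M_X\}\setminus\{(1,0)\}$, $p^X_{0,0}:=1$ and, for $m\neq0$, $$p^X_{a,m}(x)=\sqrt2\,\mathrm{Re}\Bigl(e^{-a\pi i/2}\prod_{\ell=1}^{d_X}e^{-2\pi i m_\ell x_\ell}\Bigr);$$ define $\mathcal K$ and $p^Y_{a,m}$ in the same way from $M_Y\subseteq\mathbb Z^{d_Y}$. For $j=(a_X,m_X)\in\mathcal J$ and $k=(a_Y,m_Y)\in\mathcal K$ let $\theta_{jk}=\|m_X\|_1^{s_X}\vee\|m_Y\|_1^{s_Y}$ if $m_X\ne0$ and $m_Y\neq 0$, and $\theta_{jk}=\infty$ otherwise. Put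 $\xi=(\theta,r,A)$. For a density $f\in L^2(\mu)$ with marginal densities $f_X,f_Y$ let $a_{jk}(f)=\int f(x,y)\,p^X_j(x)p^Y_k(y)\,d\mu$, $a_{j\bullet}(f)=\int f_Xp^X_j\,d\mu_X$, $a_{\bullet k}(f)=\int f_Yp^Y_k\,d\mu_Y$, $$D(f)=\int\{f(x,y)-f_X(x)f_Y(y)\}^2\,d\mu,\qquad S_\theta(f)=\sum_{j\in\mathcal J}\sum_{k\in\mathcal K}\theta_{jk}^2\{a_{jk}(f)-a_{j\bullet}(f)a_{\bullet k}(f)\}^2$$ (with $\infty\cdot0=0$), and let $\mathcal F_\xi(\rho)$ be the set of densities $f\in L^2(\mu)$ with $D(f)\ge\rho^2$, $S_\theta(f)\le r^2$ and $\max(\|f\|_\infty,\|f_X\|_\infty,\|f_Y\|_\infty)\le A$, where $\|\cdot\|_\infty$ is the supremum norm. Let $\mathbb E_f$ denote expectation over $n$ independent observations with density $f$, let $\mathbb E_1$ be the case of the uniform density $1=p^X_{0,0}p^Y_{0,0}$, and define $$\tilde{\mathcal R}(n,\xi,\rho)=\inf_\psi\Bigl\{\mathbb E_{1}(\psi)+\sup_{f\in\mathcal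 F_\xi(\rho)}\mathbb E_f(1-\psi)\Bigr\},\qquad \tilde\rho^*(n,\gamma,\xi)=\inf\{\rho>0:\tilde{\mathcal R}(n,\xi,\rho)\le\gamma\},$$ where $\psi$ ranges over all measurable functions $(\mathcal X\times\mathcal Y)^n\to[0,1]$ and a supremum over the empty set is $0$. **Proposition.** Fix $\gamma\in(0,1)$. There exist $c_1,c_2\in(0,\infty)$, depending only on $d_X,d_Y,\gamma,s_X,s_Y$ and $A$, such that for all $n\in\mathbb N$ and $r>0$ with $$nr^2\ge2\qquad\text{and}\qquad\Bigl(\frac{r^d}{n^{2s}}\Bigr)^{1/(4s+d)}\le\frac{c_1}{\log^{1/2}(nr^2)}$$ we have $$\tilde\rho^*(n,\gamma,\xi)\ \ge\ c_2\Bigl(\frac{r^d}{n^{2s}}\Bigr)^{1/(4s+d)},$$ both when $M_X=\{0,1,2,\dots\}^{d_X}$ and $M_Y=\{0,1,2,\dots\}^{d_Y}$, and when $M_X\subset\mathbb Z^{d_X}$ and $M_Y\subset\mathbb Z^{d_Y}$ consist of $0$ and of all vectors whose first non-zero entry is positive (in which case the functions $p^X_j$ and $p^Y_k$ form orthonormal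 bases of $L^2(\mu_X)$ and $L^2(\mu_Y)$). -/

import Mathlib

open MeasureTheory
open scoped ENNReal

noncomputable section

namespace IndepTest

section General

variable {X Y J K : Type*} [MeasurableSpace X] [MeasurableSpace Y]

/-- The class of square-integrable density functions on a measure space. -/
def IsDensity {Z : Type*} [MeasurableSpace Z] (μ : Measure Z) (f : Z → ℝ) : Prop :=
  Measurable f ∧ MemLp f 2 μ ∧ (∀ᵐ z ∂μ, 0 ≤ f z) ∧ ∫ z, f z ∂μ = 1

/-- The marginal density of the first coordinate. -/
def marginalX (μY : Measure Y) (f : X × Y → ℝ) (x : X) : ℝ := ∫ y, f (x, y) ∂μY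

/-- The marginal density of the second coordinate. -/
def marginalY (μX : Measure X) (f : X × Y → ℝ) (y : Y) : ℝ := ∫ x, f (x, y) ∂μX

/-- The measure of dependence: the squared `L²` distance between the joint density and the
product of its marginal densities. -/
def dependence (μX : Measure X) (μY : Measure Y) (f : X × Y → ℝ) : ℝ :=
  ∫ z, (f z - marginalX μY f z.1 * marginalY μX f z.2) ^ 2 ∂(μX.prod μY)

/-- The coefficient of `f` at the product function `pX j ⊗ pY k`. -/
def coeff (μX : Measure X) (μY : Measure Y) (pX : J → X → ℝ) (pY : K → Y → ℝ)
    (f : X × Y → ℝ) (j : J) (k : K) : ℝ :=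
  ∫ z, f z * (pX j z.1 * pY k z.2) ∂(μX.prod μY)

/-- The coefficient of the first marginal density at `pX j`. -/
def coeffX (μX : Measure X) (μY : Measure Y) (pX : J → X → ℝ) (f : X × Y → ℝ) (j : J) : ℝ :=
  ∫ x, marginalX μY f x * pX j x ∂μX

/-- The coefficient of the second marginal density at `pY k`. -/
def coeffY (μX : Measure X) (μY : Measure Y) (pY : K → Y → ℝ) (f : X × Y → ℝ) (k : K) : ℝ :=
  ∫ y, marginalY μX f y * pY k y ∂μY

/-- The smoothness functional
`S_θ(f) = ∑ⱼ ∑ₖ θⱼₖ² (aⱼₖ(f) - aⱼ(f) aₖ(f))²`, with values in `[0, ∞]` (and `∞ · 0 = 0`). -/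
def smoothness (μX : Measure X) (μY : Measure Y) (pX : J → X → ℝ) (pY : K → Y → ℝ)
    (θ : J → K → ℝ≥0∞) (f : X × Y → ℝ) : ℝ≥0∞ :=
  ∑' j, ∑' k, θ j k ^ 2 *
    ENNReal.ofReal
      ((coeff μX μY pX pY f j k - coeffX μX μY pX f j * coeffY μX μY pY f k) ^ 2)

/-- The space of alternatives `F_ξ(ρ)`, where `ξ = (θ, r, A)`. -/
def alternatives (μX : Measure X) (μY : Measure Y) (pX : J → X → ℝ) (pY : K → Y → ℝ)
    (θ : J → K → ℝ≥0∞) (r A ρ : ℝ) : Set (X × Y → ℝ) :=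
  {f | IsDensity (μX.prod μY) f ∧
    ρ ^ 2 ≤ dependence μX μY f ∧
    smoothness μX μY pX pY θ f ≤ ENNReal.ofReal (r ^ 2) ∧
    (∀ z, |f z| ≤ A) ∧ (∀ x, |marginalX μY f x| ≤ A) ∧ (∀ y, |marginalY μX f y| ≤ A)}

/-- The law of `n` independent observations with common distribution `P`. -/
def iidLaw {Z : Type*} [MeasurableSpace Z] (P : Measure Z) (n : ℕ) : Measure (Fin n → Z) :=
  Measure.pi fun _ => P

/-- The distribution with density `f` with respect to `μ`. -/
def densityLaw {Z : Type*} [MeasurableSpace Z] (μ : Measure Z) (f : Z → ℝ) : Measure Z :=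
  μ.withDensity fun z => ENNReal.ofReal (f z)

/-- The set `Ψ(α)` of randomised independence tests, based on `n` observations, whose probability
of rejection is at most `α` under every distribution with independent coordinates. -/
def validTests (X Y : Type*) [MeasurableSpace X] [MeasurableSpace Y] (n : ℕ) (α : ℝ) :
    Set ((Fin n → X × Y) → ℝ) :=
  {ψ | Measurable ψ ∧ (∀ w, 0 ≤ ψ w ∧ ψ w ≤ 1) ∧
    ∀ (P : Measure X) (Q : Measure Y), IsProbabilityMeasure P → IsProbabilityMeasure Q →
      ∫⁻ w, ENNReal.ofReal (ψ w) ∂(iidLaw (P.prod Q) n) ≤ ENNReal.ofReal α}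

/-- The minimax risk for a simple null: the infimum over `ψ ∈ Ψ(1)` of the sum of the probability
of a Type I error under the density `p_{j₀k₀}` and of the largest probability of a Type II error
over the alternatives (the supremum over an empty class being zero). -/
def simpleRisk (μX : Measure X) (μY : Measure Y) (pX : J → X → ℝ) (pY : K → Y → ℝ)
    (j₀ : J) (k₀ : K) (n : ℕ) (θ : J → K → ℝ≥0∞) (r A ρ : ℝ) : ℝ≥0∞ :=
  ⨅ ψ ∈ validTests X Y n 1,
    ((∫⁻ w, ENNReal.ofReal (ψ w)
        ∂(iidLaw (densityLaw (μX.prod μY) fun z => pX j₀ z.1 * pY k₀ z.2) n)) +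
      ⨆ f ∈ alternatives μX μY pX pY θ r A ρ,
        ∫⁻ w, ENNReal.ofReal (1 - ψ w) ∂(iidLaw (densityLaw (μX.prod μY) f) n))

/-- The minimax separation radius for a simple null: the infimum of all `ρ > 0` at which the risk
is at most `γ`. -/
def simpleSeparation (μX : Measure X) (μY : Measure Y) (pX : J → X → ℝ) (pY : K → Y → ℝ)
    (j₀ : J) (k₀ : K) (n : ℕ) (γ : ℝ) (θ : J → K → ℝ≥0∞) (r A : ℝ) : ℝ≥0∞ :=
  ⨅ ρ ∈ {ρ : ℝ | 0 < ρ ∧ simpleRisk μX μY pX pY j₀ k₀ n θ r A ρ ≤ ENNReal.ofReal γ},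
    ENNReal.ofReal ρ

end General

/-- The unit cube `[0, 1]ᵈ`; its `volume` is `d`-dimensional Lebesgue measure. -/
abbrev Cube (d : ℕ) : Type := Fin d → unitInterval

/-- The frequency vectors with non-negative entries. -/
def nonnegFreq (d : ℕ) : Set (Fin d → ℤ) := {m | ∀ i, 0 ≤ m i}

/-- The frequency vectors that vanish or whose first non-zero entry is positive. For every
`m ≠ 0`, exactly one of `m` and `-m` is of this kind. -/
def halfFreq (d : ℕ) : Set (Fin d → ℤ) :=
  {m | m = 0 ∨ ∃ i, 0 < m i ∧ ∀ l < i, m l = 0}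

/-- The index set `{(a, m) : a ∈ {0, 1}, m ∈ M} \ {(1, 0)}` of the Fourier functions with
frequencies in a set `M` that contains `0`. -/
def FourierIndex {d : ℕ} (M : Set (Fin d → ℤ)) : Type :=
  {p : Fin 2 × (Fin d → ℤ) // p = (0, 0) ∨ (p.2 ∈ M ∧ p.2 ≠ 0)}

/-- The index of the constant function. -/
def FourierIndex.zero {d : ℕ} (M : Set (Fin d → ℤ)) : FourierIndex M := ⟨(0, 0), Or.inl rfl⟩

/-- The frequency vector of an index. -/
def FourierIndex.freq {d : ℕ} {M : Set (Fin d → ℤ)} (j : FourierIndex M) : Fin d → ℤ := j.1.2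

/-- The norm `‖m‖₁` of the frequency vector of an index. -/
def FourierIndex.size {d : ℕ} {M : Set (Fin d → ℤ)} (j : FourierIndex M) : ℝ :=
  ∑ l, |(j.freq l : ℝ)|

/-- The Fourier functions: the constant `1` at frequency zero, and otherwise
`√2 Re (e^{-aπi/2} ∏ₗ e^{-2πi mₗ xₗ})`. -/
def fourierFun {d : ℕ} {M : Set (Fin d → ℤ)} (j : FourierIndex M) (x : Cube d) : ℝ :=
  if j.freq = 0 then 1
  else √2 * (Complex.exp (-((j.1.1 : ℕ) : ℂ) * Real.pi * Complex.I / 2) *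
    ∏ l, Complex.exp (-2 * Real.pi * Complex.I * (j.freq l : ℂ) * ((x l : ℝ) : ℂ))).re

/-- The Sobolev weights `θⱼₖ = max (‖mX‖₁ ^ sX) (‖mY‖₁ ^ sY)`, with `θⱼₖ = ∞` by convention if one
of the two functions is constant. -/
def sobolevWeight {dX dY : ℕ} {MX : Set (Fin dX → ℤ)} {MY : Set (Fin dY → ℤ)} (sX sY : ℝ)
    (j : FourierIndex MX) (k : FourierIndex MY) : ℝ≥0∞ :=
  if j.freq = 0 ∨ k.freq = 0 then ⊤
  else ENNReal.ofReal (max (j.size ^ sX) (k.size ^ sY))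

/-- The minimax separation radius for a simple null in the Sobolev problem on
`[0, 1]^dX × [0, 1]^dY`, for Fourier functions with frequencies in `MX` and `MY`. -/
def sobolevSeparation {dX dY : ℕ} (MX : Set (Fin dX → ℤ)) (MY : Set (Fin dY → ℤ))
    (n : ℕ) (γ sX sY r A : ℝ) : ℝ≥0∞ :=
  simpleSeparation (volume : Measure (Cube dX)) (volume : Measure (Cube dY))
    (fourierFun (M := MX)) (fourierFun (M := MY)) (FourierIndex.zero MX) (FourierIndex.zero MY)
    n γ (sobolevWeight sX sY) r A

/-- The effective smoothness `s = d / (dX / sX + dY / sY)` with `d = dX + dY`. -/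
def effSmoothness (dX dY : ℕ) (sX sY : ℝ) : ℝ :=
  ((dX : ℝ) + dY) / (dX / sX + dY / sY)

/-- The rate `(rᵈ / n²ˢ) ^ (1 / (4s + d))`. -/
def sobolevRate (dX dY : ℕ) (sX sY : ℝ) (n : ℕ) (r : ℝ) : ℝ :=
  (r ^ (dX + dY) / (n : ℝ) ^ (2 * effSmoothness dX dY sX sY)) ^
    (1 / (4 * effSmoothness dX dY sX sY + ((dX : ℝ) + dY)))

end IndepTest

end

/-! The bound comes from the second-moment method for mixtures. Perturb the uniform density to `1 +
δ ∑ᵢ εᵢ p_{aᵢ} ⊗ p_{bᵢ}`, with signs `ε` and N pairs of non-constant cosines whose frequencies run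
over boxes of side LX and LY. Both marginals stay exactly uniform, the dependence is δ²N, and the
smoothness functional is at most N(Θδ)² when the weights are at most Θ. Orthonormality turns the
inner product of two such densities into 1 + δ²⟨ε, ε'⟩, so averaging its n-th power over all pairs
of signs gives at most exp((nδ²)²N/2). If this is close to 1, no test separates the mixture from the
uniform law (`le_risk_of_chiSq`).

The perturbation is a density bounded by A only if its absolute value is at most τ = min(1, A - 1).
The trivial bound 2δN is too weak. Random signs give order δ√(N log): Hoeffding's inequality and a
union bound over a grid (`card_signs_sup_gt_le`) show that all but a fraction η of the sign vectors
are admissible. Restricting the mixture to these costs only a factor (1 - η)⁻² in the second moment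
(`ProductSystem.le_simpleRisk`).

For the calibration let R be the rate, T = nr² and B = T^(2s/(4s+d)). With LX ≈ B^(1/sX), LY ≈
B^(1/sY) and δ²N = (cR)², everything rests on RB = r (smoothness), N ≈ B^(d/s) =: P, and n²R⁴ = P
(indistinguishability). The sup-norm requirement becomes c²R² log T ≲ τ², which is where the
logarithmic condition enters (`le_sobolevSeparation`). -/

noncomputable section

namespace IndepTest

/-! ### Testing against a finite mixture: the χ² bound. -/

section LowerBound

variable {Z : Type*} [MeasurableSpace Z]

theorem integrable_of_abs_le {μ : Measure Z} [IsFiniteMeasure μ] {f : Z → ℝ} {C : ℝ}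
    (hf : Measurable f) (hC : ∀ z, |f z| ≤ C) : Integrable f μ :=
  Integrable.of_bound hf.aestronglyMeasurable C (Filter.Eventually.of_forall hC)

theorem lintegral_ofReal_prod {μ : Measure Z} [IsProbabilityMeasure μ] {n : ℕ}
    (f : Fin n → Z → ℝ) (hf : ∀ i, Integrable (f i) μ) (h0 : ∀ i z, 0 ≤ f i z) :
    ∫⁻ w : Fin n → Z, ENNReal.ofReal (∏ i, f i (w i)) ∂(Measure.pi fun _ => μ) =
      ∏ i, ∫⁻ z, ENNReal.ofReal (f i z) ∂μ := by
  rw [← ofReal_integral_eq_lintegral_ofReal (Integrable.fintype_prod hf)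
    (Filter.Eventually.of_forall fun w => Finset.prod_nonneg fun i _ => h0 i _),
    integral_fintype_prod_eq_prod, ENNReal.ofReal_prod_of_nonneg
      (fun i _ => integral_nonneg (h0 i))]
  refine Finset.prod_congr rfl fun i _ => ?_
  rw [ofReal_integral_eq_lintegral_ofReal (hf i) (Filter.Eventually.of_forall (h0 i))]

/-- It suffices to compare both measures on boxes, where the indicator of the box factorises along
with the density. -/
theorem iidLaw_densityLaw {μ : Measure Z} [IsProbabilityMeasure μ] {n : ℕ}
    {f : Z → ℝ} (hf : Integrable f μ) (h0 : ∀ z, 0 ≤ f z) :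
    iidLaw (densityLaw μ f) n =
      (Measure.pi fun _ : Fin n => μ).withDensity fun w => ENNReal.ofReal (∏ i, f (w i)) := by
  have : IsFiniteMeasure (densityLaw μ f) :=
    isFiniteMeasure_withDensity_ofReal hf.2
  refine Measure.pi_eq fun s hs => ?_
  rw [withDensity_apply _ (MeasurableSet.univ_pi hs),
    ← lintegral_indicator (MeasurableSet.univ_pi hs)]
  have h1 : ∀ w : Fin n → Z, (Set.univ.pi s).indicator
      (fun w => ENNReal.ofReal (∏ i, f (w i))) w =
      ENNReal.ofReal (∏ i, (s i).indicator f (w i)) := by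
    intro w
    by_cases hw : w ∈ Set.univ.pi s
    · rw [Set.indicator_of_mem hw]
      congr 1
      refine Finset.prod_congr rfl fun i _ => ?_
      rw [Set.indicator_of_mem (hw i (Set.mem_univ i))]
    · rw [Set.indicator_of_notMem hw]
      simp only [Set.mem_univ_pi, not_forall] at hw
      obtain ⟨i, hi⟩ := hw
      rw [Finset.prod_eq_zero (Finset.mem_univ i) (Set.indicator_of_notMem hi f)]
      simp
  simp_rw [h1]
  rw [lintegral_ofReal_prod (fun i => (s i).indicator f) (fun i => hf.indicator (hs i))
    (fun i z => Set.indicator_nonneg (fun z _ => h0 z) z)]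
  refine Finset.prod_congr rfl fun i _ => ?_
  rw [densityLaw, withDensity_apply _ (hs i), ← lintegral_indicator (hs i)]
  refine lintegral_congr fun z => ?_
  by_cases hz : z ∈ s i <;> simp [hz]

/-- A lower bound for the sum of the error probabilities of a test between `μ` and a finite
mixture, in terms of the `χ²`-divergence. -/
theorem le_risk_of_chiSq {E : Type*} {μ : Measure Z} [IsProbabilityMeasure μ] {n : ℕ}
    {κ C : ℝ} (hκ : 0 < κ) (G : Finset E) (hG : G.Nonempty) (f : E → Z → ℝ)
    (hm : ∀ e ∈ G, Measurable (f e)) (h0 : ∀ e ∈ G, ∀ z, 0 ≤ f e z)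
    (hC : ∀ e ∈ G, ∀ z, f e z ≤ C) (h1 : ∀ e ∈ G, ∫ z, f e z ∂μ = 1)
    (hχ : ∑ e ∈ G, ∑ e' ∈ G, (∫ z, f e z * f e' z ∂μ) ^ n ≤ (1 + κ ^ 2) * (G.card : ℝ) ^ 2)
    {ψ : (Fin n → Z) → ℝ} (hψ : Measurable ψ) (hψ01 : ∀ w, 0 ≤ ψ w ∧ ψ w ≤ 1) {R : ℝ≥0∞}
    (hR : ∀ e ∈ G, ∫⁻ w, ENNReal.ofReal (1 - ψ w) ∂(iidLaw (densityLaw μ (f e)) n) ≤ R) :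
    ENNReal.ofReal (1 - κ) ≤ ∫⁻ w, ENNReal.ofReal (ψ w) ∂(iidLaw μ n) + R := by
  by_cases hRtop : R = ⊤
  · simp [hRtop]
  set ν : Measure (Fin n → Z) := Measure.pi fun _ => μ with hν
  have hcard : (0 : ℝ) < G.card := by exact_mod_cast hG.card_pos
  let g : E → (Fin n → Z) → ℝ := fun e w => ∏ i, f e (w i)
  have hgm : ∀ e ∈ G, Measurable (g e) := fun e he =>
    Finset.measurable_prod _ fun i _ => (hm e he).comp (measurable_pi_apply i)
  have hg0 : ∀ e ∈ G, ∀ w, 0 ≤ g e w := fun e he w =>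
    Finset.prod_nonneg fun i _ => h0 e he _
  have hgC : ∀ e ∈ G, ∀ w, g e w ≤ C ^ n := fun e he w => by
    calc g e w ≤ ∏ _i : Fin n, C := Finset.prod_le_prod (fun i _ => h0 e he _)
          (fun i _ => hC e he _)
      _ = C ^ n := by simp
  have hfint : ∀ e ∈ G, Integrable (f e) μ := fun e he =>
    integrable_of_abs_le (hm e he) fun z => (abs_of_nonneg (h0 e he z)).trans_le (hC e he z)
  have hgint : ∀ e ∈ G, Integrable (g e) ν := fun e he =>
    integrable_of_abs_le (hgm e he) fun z => (abs_of_nonneg (hg0 e he z)).trans_le (hgC e he z)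
  have hggint : ∀ e ∈ G, ∀ e' ∈ G, Integrable (fun w => g e w * g e' w) ν := fun e he e' he' =>
    integrable_of_abs_le (C := C ^ n * C ^ n) ((hgm e he).mul (hgm e' he')) fun w => by
      rw [abs_of_nonneg (mul_nonneg (hg0 e he w) (hg0 e' he' w))]
      exact mul_le_mul (hgC e he w) (hgC e' he' w) (hg0 e' he' w)
        ((hg0 e he w).trans (hgC e he w))
  have hψint : Integrable ψ ν := integrable_of_abs_le hψ fun w => by
    rw [abs_of_nonneg (hψ01 w).1]; exact (hψ01 w).2
  have hgψint : ∀ e ∈ G, Integrable (fun w => g e w * (1 - ψ w)) ν := fun e he =>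
    integrable_of_abs_le (C := C ^ n) ((hgm e he).mul (measurable_const.sub hψ)) fun w => by
      rw [abs_of_nonneg (mul_nonneg (hg0 e he w) (sub_nonneg.2 (hψ01 w).2))]
      calc g e w * (1 - ψ w) ≤ g e w * 1 :=
            mul_le_mul_of_nonneg_left (by linarith [(hψ01 w).1]) (hg0 e he w)
        _ ≤ C ^ n := by rw [mul_one]; exact hgC e he w
  have hRreal : ∀ e ∈ G, ∫ w, g e w * (1 - ψ w) ∂ν ≤ R.toReal := by
    intro e he
    have := hR e he
    rw [iidLaw_densityLaw (hfint e he) (h0 e he),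
      lintegral_withDensity_eq_lintegral_mul _ (hgm e he).ennreal_ofReal
        (g := fun w => ENNReal.ofReal (1 - ψ w))
        (measurable_const.sub hψ).ennreal_ofReal] at this
    simp only [Pi.mul_apply] at this
    simp_rw [← ENNReal.ofReal_mul (hg0 e he _)] at this
    rw [← ofReal_integral_eq_lintegral_ofReal (hgψint e he)
      (Filter.Eventually.of_forall fun w =>
        mul_nonneg (hg0 e he w) (sub_nonneg.2 (hψ01 w).2))] at this
    exact (ENNReal.ofReal_le_iff_le_toReal hRtop).1 this
  -- The likelihood ratio of the uniform mixture over `G`. The risk is at least the integral of ψ +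
  -- L(1 - ψ).
  let L : (Fin n → Z) → ℝ := fun w => (∑ e ∈ G, g e w) / G.card
  have hLint : Integrable L ν := (integrable_finsetSum G hgint).div_const _
  have hL2 : ∀ w, L w ^ 2 = (∑ e ∈ G, ∑ e' ∈ G, g e w * g e' w) / (G.card : ℝ) ^ 2 := by
    intro w
    simp only [L]
    rw [div_pow, sq (∑ e ∈ G, g e w), Finset.sum_mul_sum]
  have hL2int : Integrable (fun w => L w ^ 2) ν := by
    simp_rw [hL2]
    exact (integrable_finsetSum G fun e he => integrable_finsetSum G fun e' he' =>
      hggint e he e' he').div_const _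
  have hLψint : Integrable (fun w => L w * (1 - ψ w)) ν := by
    have : (fun w => L w * (1 - ψ w)) = fun w => (∑ e ∈ G, g e w * (1 - ψ w)) / G.card := by
      ext w; simp only [L]; rw [← Finset.sum_mul]; ring
    rw [this]
    exact (integrable_finsetSum G hgψint).div_const _
  have hLone : ∫ w, L w ∂ν = 1 := by
    simp only [L]
    rw [integral_div, integral_finsetSum G hgint]
    have : ∀ e ∈ G, ∫ w, g e w ∂ν = 1 := fun e he => by
      simp only [g, hν]
      rw [integral_fintype_prod_eq_prod (fun _ => f e)]
      simp [h1 e he]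
    rw [Finset.sum_congr rfl this]
    simp [hcard.ne']
  have hLsq : ∫ w, L w ^ 2 ∂ν ≤ 1 + κ ^ 2 := by
    simp_rw [hL2]
    rw [integral_div, integral_finsetSum G fun e he => integrable_finsetSum G fun e' he' =>
      hggint e he e' he', div_le_iff₀ (by positivity)]
    refine le_of_eq_of_le (Finset.sum_congr rfl fun e he => ?_) hχ
    rw [integral_finsetSum G (hggint e he)]
    refine Finset.sum_congr rfl fun e' he' => ?_
    simp only [g, hν, ← Finset.prod_mul_distrib]
    rw [integral_fintype_prod_eq_prod (fun _ z => f e z * f e' z)]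
    simp
  have hLψ : ∫ w, L w * (1 - ψ w) ∂ν ≤ R.toReal := by
    have : (fun w => L w * (1 - ψ w)) = fun w => (∑ e ∈ G, g e w * (1 - ψ w)) / G.card := by
      ext w; simp only [L]; rw [← Finset.sum_mul]; ring
    rw [this, integral_div, integral_finsetSum G hgψint, div_le_iff₀ hcard]
    calc ∑ e ∈ G, ∫ w, g e w * (1 - ψ w) ∂ν ≤ ∑ _e ∈ G, R.toReal := Finset.sum_le_sum hRreal
      _ = R.toReal * G.card := by simp [mul_comm]
  -- Since ψ + L(1 - ψ) = 1 + (L - 1)(1 - ψ) ≥ 1 - |L - 1|, it remains to bound |L - 1| ≤ κ/2 + (L -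
  -- 1)²/(2κ). The right side integrates to at most κ, because ∫(L - 1)² ≤ κ².
  have hptw : ∀ w, 1 - κ / 2 - (L w ^ 2 - 2 * L w + 1) / (2 * κ) ≤ ψ w + L w * (1 - ψ w) := by
    intro w
    have ha : 1 - |L w - 1| ≤ ψ w + L w * (1 - ψ w) := by
      obtain ⟨p0, p1⟩ := hψ01 w
      rcases abs_cases (L w - 1) with ⟨h, _⟩ | ⟨h, _⟩ <;> rw [h] <;> nlinarith
    have hb : |L w - 1| ≤ κ / 2 + (L w ^ 2 - 2 * L w + 1) / (2 * κ) := by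
      have : κ / 2 + (L w ^ 2 - 2 * L w + 1) / (2 * κ) - |L w - 1| =
          (|L w - 1| - κ) ^ 2 / (2 * κ) := by
        field_simp
        have := sq_abs (L w - 1)
        linear_combination -this
      have h2 : 0 ≤ (|L w - 1| - κ) ^ 2 / (2 * κ) := by positivity
      linarith
    linarith
  have hq2 : Integrable (fun w => L w ^ 2 - 2 * L w) ν := hL2int.sub (hLint.const_mul 2)
  have hq : Integrable (fun w => L w ^ 2 - 2 * L w + 1) ν :=
    hq2.add (integrable_const 1)
  have hmono := integral_mono
    (((integrable_const (1 - κ / 2)).sub (hq.div_const (2 * κ)))) (hψint.add hLψint) hptw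
  have e1 : ∫ w, ((fun _ => 1 - κ / 2) - fun w => (L w ^ 2 - 2 * L w + 1) / (2 * κ) :
      (Fin n → Z) → ℝ) w ∂ν =
      1 - κ / 2 - (∫ w, L w ^ 2 ∂ν - 2 * 1 + 1) / (2 * κ) := by
    simp only [Pi.sub_apply]
    rw [integral_sub (integrable_const _) (hq.div_const _), integral_div,
      integral_add hq2 (integrable_const 1),
      integral_sub hL2int (hLint.const_mul 2), integral_const_mul, hLone]
    simp
  have e2 : ∫ w, (ψ + fun w => L w * (1 - ψ w)) w ∂ν =
      ∫ w, ψ w ∂ν + ∫ w, L w * (1 - ψ w) ∂ν := integral_add hψint hLψint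
  rw [e1, e2] at hmono
  have hfin : (∫ w, L w ^ 2 ∂ν - 2 * 1 + 1) / (2 * κ) ≤ κ / 2 := by
    rw [div_le_iff₀ (by positivity)]
    nlinarith
  have hreal : 1 - κ ≤ ∫ w, ψ w ∂ν + R.toReal := by linarith
  calc ENNReal.ofReal (1 - κ) ≤ ENNReal.ofReal (∫ w, ψ w ∂ν + R.toReal) :=
        ENNReal.ofReal_le_ofReal hreal
    _ = ∫⁻ w, ENNReal.ofReal (ψ w) ∂ν + R := by
        rw [ENNReal.ofReal_add (integral_nonneg fun w => (hψ01 w).1) ENNReal.toReal_nonneg,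
          ENNReal.ofReal_toReal hRtop, ofReal_integral_eq_lintegral_ofReal hψint
            (Filter.Eventually.of_forall fun w => (hψ01 w).1)]

end LowerBound

/-! ### Random signs, with probabilities written as counts of sign vectors. -/

section Rademacher

variable {ι : Type*} [Fintype ι] [DecidableEq ι]

variable (ι) in
/-- The vectors of signs. -/
def signs : Finset (ι → ℝ) := Fintype.piFinset fun _ => ({1, -1} : Finset ℝ)

theorem sq_of_mem_signs {ε : ι → ℝ} (hε : ε ∈ signs ι) (i : ι) : ε i ^ 2 = 1 := by
  have := Fintype.mem_piFinset.1 hε i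
  simp only [Finset.mem_insert, Finset.mem_singleton] at this
  rcases this with h | h <;> simp [h]

theorem card_signs : ((signs ι).card : ℝ) = 2 ^ Fintype.card ι := by
  have : ({1, -1} : Finset ℝ).card = 2 := Finset.card_pair (by norm_num)
  simp [signs, Fintype.card_piFinset, this]

/-- Sub-Gaussianity of sums with random signs. -/
theorem sum_signs_exp_le (a : ι → ℝ) :
    ∑ ε ∈ signs ι, Real.exp (∑ i, ε i * a i) ≤
      2 ^ Fintype.card ι * Real.exp ((∑ i, a i ^ 2) / 2) := by
  have h : ∑ ε ∈ signs ι, Real.exp (∑ i, ε i * a i) = ∏ i, (2 * Real.cosh (a i)) := by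
    have := Finset.prod_univ_sum (fun _ : ι => ({1, -1} : Finset ℝ))
      (fun i e => Real.exp (e * a i))
    simp_rw [signs, Real.exp_sum]
    rw [← this]
    refine Finset.prod_congr rfl fun i _ => ?_
    rw [Finset.sum_pair (by norm_num), Real.cosh_eq]
    simp
    ring
  rw [h, Finset.prod_mul_distrib, Finset.prod_const, Finset.sum_div, Real.exp_sum]
  refine mul_le_mul_of_nonneg_left ?_ (by positivity)
  exact Finset.prod_le_prod (fun i _ => (Real.cosh_pos _).le)
    (fun i _ => Real.cosh_le_exp_half_sq _)

/-- Chernoff's bound with the optimal tilt u/V. -/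
theorem card_signs_sum_gt_le (a : ι → ℝ) {u V : ℝ} (hV : 0 < V) (hu : 0 ≤ u)
    (ha : ∑ i, a i ^ 2 ≤ V) :
    (((signs ι).filter fun ε => u < ∑ i, ε i * a i).card : ℝ) ≤
      2 ^ Fintype.card ι * Real.exp (-(u ^ 2 / (2 * V))) := by
  have h1 : (((signs ι).filter fun ε => u < ∑ i, ε i * a i).card : ℝ) * Real.exp (u / V * u) ≤
      ∑ ε ∈ signs ι, Real.exp (∑ i, ε i * (u / V * a i)) := by
    rw [← nsmul_eq_mul, ← Finset.sum_const]
    refine (Finset.sum_le_sum (g := fun ε => Real.exp (∑ i, ε i * (u / V * a i)))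
      fun ε hε => ?_).trans
      (Finset.sum_le_sum_of_subset_of_nonneg (Finset.filter_subset _ _)
        fun _ _ _ => (Real.exp_pos _).le)
    rw [Finset.mem_filter] at hε
    refine Real.exp_le_exp.2 ?_
    have : ∑ i, ε i * (u / V * a i) = u / V * ∑ i, ε i * a i := by
      rw [Finset.mul_sum]; exact Finset.sum_congr rfl fun i _ => by ring
    rw [this]
    exact mul_le_mul_of_nonneg_left hε.2.le (by positivity)
  have h2 := h1.trans (sum_signs_exp_le fun i => u / V * a i)
  have h3 : (∑ i, (u / V * a i) ^ 2) / 2 ≤ u ^ 2 / (2 * V) := by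
    simp_rw [mul_pow, ← Finset.mul_sum]
    calc (u / V) ^ 2 * (∑ i, a i ^ 2) / 2 ≤ (u / V) ^ 2 * V / 2 := by gcongr
      _ = u ^ 2 / (2 * V) := by field_simp
  have h4 : Real.exp (u / V * u) = Real.exp (u ^ 2 / (2 * V)) * Real.exp (u ^ 2 / (2 * V)) := by
    rw [← Real.exp_add]; congr 1; field_simp; ring
  rw [Real.exp_neg, ← div_eq_mul_inv, le_div_iff₀ (Real.exp_pos _)]
  refine le_of_mul_le_mul_right ?_ (Real.exp_pos (u ^ 2 / (2 * V)))
  rw [mul_assoc, ← h4]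
  exact h2.trans (by gcongr)

theorem card_signs_abs_sum_gt_le (a : ι → ℝ) {u V : ℝ} (hV : 0 < V) (hu : 0 ≤ u)
    (ha : ∑ i, a i ^ 2 ≤ V) :
    (((signs ι).filter fun ε => u < |∑ i, ε i * a i|).card : ℝ) ≤
      2 ^ Fintype.card ι * (2 * Real.exp (-(u ^ 2 / (2 * V)))) := by
  have hsub : ((signs ι).filter fun ε => u < |∑ i, ε i * a i|) ⊆
      ((signs ι).filter fun ε => u < ∑ i, ε i * a i) ∪
      ((signs ι).filter fun ε => u < ∑ i, ε i * (-a i)) := by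
    intro ε hε
    simp only [Finset.mem_filter, Finset.mem_union, mul_neg, Finset.sum_neg_distrib] at hε ⊢
    rcases lt_abs.1 hε.2 with h | h
    · exact Or.inl ⟨hε.1, h⟩
    · exact Or.inr ⟨hε.1, h⟩
  have h1 := (Finset.card_le_card hsub).trans (Finset.card_union_le _ _)
  have h2 := card_signs_sum_gt_le a hV hu ha
  have h3 := card_signs_sum_gt_le (fun i => -a i) hV hu (by simpa using ha)
  have h4 : (((signs ι).filter fun ε => u < |∑ i, ε i * a i|).card : ℝ) ≤
      ((signs ι).filter fun ε => u < ∑ i, ε i * a i).card +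
      ((signs ι).filter fun ε => u < ∑ i, ε i * (-a i)).card := by exact_mod_cast h1
  linarith

/-- A uniform bound for sums of functions with random signs, by a union bound over a net. -/
theorem card_signs_sup_gt_le {Z γ : Type*} [Fintype γ] [Nonempty ι] (φ : ι → Z → ℝ)
    (hφ : ∀ i z, |φ i z| ≤ 2) (net : γ → Z) {Δ t : ℝ} (ht : 0 ≤ t)
    (hnet : ∀ z, ∃ c, ∀ i, |φ i z - φ i (net c)| ≤ Δ) (hΔ : Fintype.card ι * Δ ≤ t / 2)
    {B : Finset (ι → ℝ)} (hB : B ⊆ signs ι) (hBt : ∀ ε ∈ B, ∃ z, t < |∑ i, ε i * φ i z|) :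
    (B.card : ℝ) ≤
      2 ^ Fintype.card ι *
        (Fintype.card γ * (2 * Real.exp (-((t / 2) ^ 2 / (2 * (4 * Fintype.card ι)))))) := by
  classical
  have hsub : B ⊆
      Finset.univ.biUnion fun c : γ =>
        (signs ι).filter fun ε => t / 2 < |∑ i, ε i * φ i (net c)| := by
    intro ε hε
    obtain ⟨z, hz⟩ := hBt ε hε
    replace hε := hB hε
    obtain ⟨c, hc⟩ := hnet z
    simp only [Finset.mem_biUnion, Finset.mem_filter, Finset.mem_univ, true_and]
    refine ⟨c, hε, ?_⟩
    -- Moving to the net costs at most half of the threshold `t`; the other half is left to the tail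
    -- bound at the net points.
    have h1 : |∑ i, ε i * φ i z - ∑ i, ε i * φ i (net c)| ≤ Fintype.card ι * Δ := by
      rw [← Finset.sum_sub_distrib]
      refine (Finset.abs_sum_le_sum_abs _ _).trans ?_
      calc ∑ i, |ε i * φ i z - ε i * φ i (net c)| ≤ ∑ _i : ι, Δ := by
            refine Finset.sum_le_sum fun i _ => ?_
            have h2 : |ε i| = 1 := by
              have := sq_of_mem_signs hε i
              rw [← sq_abs] at this
              exact (pow_eq_one_iff_of_nonneg (abs_nonneg _) two_ne_zero).1 this
            rw [← mul_sub, abs_mul, h2, one_mul]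
            exact hc i
        _ = Fintype.card ι * Δ := by simp
    have := abs_sub_abs_le_abs_sub (∑ i, ε i * φ i z) (∑ i, ε i * φ i (net c))
    linarith
  have hN : (0 : ℝ) < Fintype.card ι := by exact_mod_cast Fintype.card_pos
  calc (B.card : ℝ)
      ≤ ∑ c : γ, (((signs ι).filter fun ε => t / 2 < |∑ i, ε i * φ i (net c)|).card : ℝ) := by
        exact_mod_cast (Finset.card_le_card hsub).trans Finset.card_biUnion_le
    _ ≤ ∑ _c : γ, 2 ^ Fintype.card ι *
          (2 * Real.exp (-((t / 2) ^ 2 / (2 * (4 * Fintype.card ι))))) := by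
        refine Finset.sum_le_sum fun c _ => ?_
        refine card_signs_abs_sum_gt_le _ (by positivity) (by positivity) ?_
        calc ∑ i, φ i (net c) ^ 2 ≤ ∑ _i : ι, (4 : ℝ) := by
              refine Finset.sum_le_sum fun i _ => ?_
              have := hφ i (net c)
              rw [← sq_abs]
              nlinarith [abs_nonneg (φ i (net c))]
          _ = 4 * Fintype.card ι := by simp [mul_comm]
    _ = 2 ^ Fintype.card ι *
          (Fintype.card γ * (2 * Real.exp (-((t / 2) ^ 2 / (2 * (4 * Fintype.card ι)))))) := by
        rw [Finset.sum_const, Finset.card_univ, nsmul_eq_mul, mul_left_comm]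

/-- For fixed `ε` the inner sum is an exponential moment with coefficients vεᵢ, whose squares add up
to v² times the number of signs whatever `ε` is. -/
theorem sum_signs_sum_signs_exp_le (v : ℝ) :
    ∑ ε ∈ signs ι, ∑ ε' ∈ signs ι, Real.exp (v * ∑ i, ε i * ε' i) ≤
      (2 ^ Fintype.card ι) ^ 2 * Real.exp (v ^ 2 * Fintype.card ι / 2) := by
  calc ∑ ε ∈ signs ι, ∑ ε' ∈ signs ι, Real.exp (v * ∑ i, ε i * ε' i)
      ≤ ∑ _ε ∈ signs ι, 2 ^ Fintype.card ι * Real.exp (v ^ 2 * Fintype.card ι / 2) := by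
        refine Finset.sum_le_sum fun ε hε => ?_
        have h := sum_signs_exp_le fun i => v * ε i
        have h2 : ∑ i, (v * ε i) ^ 2 = v ^ 2 * Fintype.card ι := by
          simp_rw [mul_pow, sq_of_mem_signs hε]
          simp [mul_comm]
        rw [h2] at h
        refine le_of_eq_of_le (Finset.sum_congr rfl fun ε' _ => ?_) h
        rw [Finset.mul_sum]
        congr 1
        exact Finset.sum_congr rfl fun i _ => by ring
    _ = _ := by
        rw [Finset.sum_const, nsmul_eq_mul, card_signs]; ring

end Rademacher

/-! ### Perturbations of the uniform density by products of orthonormal functions. -/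

section Perturbation

variable {X Y J K ι : Type*} [MeasurableSpace X] [MeasurableSpace Y]

/-- Bounded orthonormal families of functions, one of which is the constant `1`. -/
structure IsBoundedOrthonormal (μ : Measure X) (p : J → X → ℝ) (j₀ : J) : Prop where
  measurable : ∀ j, Measurable (p j)
  abs_le : ∀ j x, |p j x| ≤ √2
  one : ∀ x, p j₀ x = 1
  norm : ∀ j, ∫ x, p j x * p j x ∂μ = 1
  orthogonal : ∀ j j', j ≠ j' → ∫ x, p j x * p j' x ∂μ = 0

theorem IsBoundedOrthonormal.integral_eq_zero {μ : Measure X} {p : J → X → ℝ} {j₀ : J}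
    (h : IsBoundedOrthonormal μ p j₀) {j : J} (hj : j ≠ j₀) : ∫ x, p j x ∂μ = 0 := by
  have := h.orthogonal j j₀ hj
  simpa [h.one] using this

/-- The systems consisting of finitely many distinct products of non-constant functions from two
bounded orthonormal families. -/
structure ProductSystem (μX : Measure X) (μY : Measure Y) (pX : J → X → ℝ) (pY : K → Y → ℝ)
    (j₀ : J) (k₀ : K) (a : ι → J) (b : ι → K) : Prop where
  left : IsBoundedOrthonormal μX pX j₀
  right : IsBoundedOrthonormal μY pY k₀
  inj : ∀ i i', a i = a i' → b i = b i' → i = i'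
  left_ne : ∀ i, a i ≠ j₀
  right_ne : ∀ i, b i ≠ k₀

namespace ProductSystem

variable {μX : Measure X} {μY : Measure Y} {pX : J → X → ℝ} {pY : K → Y → ℝ} {j₀ : J} {k₀ : K}
  {a : ι → J} {b : ι → K}

theorem abs_mul_le (h : ProductSystem μX μY pX pY j₀ k₀ a b) (j : J) (k : K) (z : X × Y) :
    |pX j z.1 * pY k z.2| ≤ 2 := by
  rw [abs_mul]
  calc |pX j z.1| * |pY k z.2| ≤ √2 * √2 :=
        mul_le_mul (h.left.abs_le j _) (h.right.abs_le k _) (abs_nonneg _) (Real.sqrt_nonneg _)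
    _ = 2 := by norm_num

theorem measurable_mul (h : ProductSystem μX μY pX pY j₀ k₀ a b) (j : J) (k : K) :
    Measurable fun z : X × Y => pX j z.1 * pY k z.2 :=
  ((h.left.measurable j).comp measurable_fst).mul ((h.right.measurable k).comp measurable_snd)

end ProductSystem

variable [Fintype ι]

/-- A linear combination of products of functions. -/
def prodComb (pX : J → X → ℝ) (pY : K → Y → ℝ) (a : ι → J) (b : ι → K) (ε : ι → ℝ)
    (z : X × Y) : ℝ :=
  ∑ i, ε i * (pX (a i) z.1 * pY (b i) z.2)

namespace ProductSystem

variable {μX : Measure X} {μY : Measure Y} {pX : J → X → ℝ} {pY : K → Y → ℝ} {j₀ : J} {k₀ : K}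
  {a : ι → J} {b : ι → K} [IsProbabilityMeasure μX] [IsProbabilityMeasure μY]

theorem integral_mul_mul (j j' : J) (k k' : K) :
    ∫ z : X × Y, (pX j z.1 * pY k z.2) * (pX j' z.1 * pY k' z.2) ∂(μX.prod μY) =
      (∫ x, pX j x * pX j' x ∂μX) * ∫ y, pY k y * pY k' y ∂μY := by
  rw [← integral_prod_mul]
  exact integral_congr_ae (Filter.Eventually.of_forall fun z => by ring)

theorem integrable_mul_mul (h : ProductSystem μX μY pX pY j₀ k₀ a b) (j j' : J) (k k' : K) :
    Integrable (fun z : X × Y => (pX j z.1 * pY k z.2) * (pX j' z.1 * pY k' z.2))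
      (μX.prod μY) :=
  integrable_of_abs_le (C := 2 * 2) ((h.measurable_mul j k).mul (h.measurable_mul j' k')) fun z => by
    rw [abs_mul]
    exact mul_le_mul (h.abs_mul_le j k z) (h.abs_mul_le j' k' z) (abs_nonneg _) (by norm_num)

theorem integrable_mul (h : ProductSystem μX μY pX pY j₀ k₀ a b) (j : J) (k : K) :
    Integrable (fun z : X × Y => pX j z.1 * pY k z.2) (μX.prod μY) :=
  integrable_of_abs_le (h.measurable_mul j k) (h.abs_mul_le j k)

theorem measurable_prodComb (h : ProductSystem μX μY pX pY j₀ k₀ a b) (ε : ι → ℝ) :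
    Measurable (prodComb pX pY a b ε) :=
  Finset.measurable_sum _ fun i _ => (h.measurable_mul (a i) (b i)).const_mul (ε i)

theorem integrable_prodComb (h : ProductSystem μX μY pX pY j₀ k₀ a b) (ε : ι → ℝ) :
    Integrable (prodComb pX pY a b ε) (μX.prod μY) :=
  integrable_finsetSum _ fun i _ => (h.integrable_mul (a i) (b i)).const_mul (ε i)

theorem integral_prodComb (h : ProductSystem μX μY pX pY j₀ k₀ a b) (ε : ι → ℝ) :
    ∫ z, prodComb pX pY a b ε z ∂(μX.prod μY) = 0 := by
  simp only [prodComb]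
  rw [integral_finsetSum _ fun i _ => (h.integrable_mul (a i) (b i)).const_mul (ε i)]
  refine Finset.sum_eq_zero fun i _ => ?_
  rw [integral_const_mul, integral_prod_mul, h.left.integral_eq_zero (h.left_ne i)]
  simp

theorem integrable_prodComb_mul (h : ProductSystem μX μY pX pY j₀ k₀ a b) (ε : ι → ℝ)
    (j : J) (k : K) :
    Integrable (fun z => prodComb pX pY a b ε z * (pX j z.1 * pY k z.2)) (μX.prod μY) := by
  simp only [prodComb, Finset.sum_mul, mul_assoc (ε _)]
  exact integrable_finsetSum _ fun i _ => (h.integrable_mul_mul _ _ _ _).const_mul (ε i)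

theorem integral_prodComb_mul (h : ProductSystem μX μY pX pY j₀ k₀ a b) (ε : ι → ℝ)
    (j : J) (k : K) :
    ∫ z, prodComb pX pY a b ε z * (pX j z.1 * pY k z.2) ∂(μX.prod μY) =
      ∑ i, ε i * ((∫ x, pX (a i) x * pX j x ∂μX) * ∫ y, pY (b i) y * pY k y ∂μY) := by
  simp only [prodComb, Finset.sum_mul, mul_assoc (ε _)]
  rw [integral_finsetSum _ fun i _ => (h.integrable_mul_mul _ _ _ _).const_mul (ε i)]
  simp_rw [integral_const_mul, integral_mul_mul]

theorem integral_prodComb_mul_self (h : ProductSystem μX μY pX pY j₀ k₀ a b) (ε : ι → ℝ)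
    (i : ι) :
    ∫ z, prodComb pX pY a b ε z * (pX (a i) z.1 * pY (b i) z.2) ∂(μX.prod μY) = ε i := by
  rw [h.integral_prodComb_mul, Finset.sum_eq_single i]
  · simp [h.left.norm, h.right.norm]
  · intro i' _ hi
    by_cases ha : a i' = a i
    · have hb : b i' ≠ b i := fun hb => hi (h.inj _ _ ha hb)
      simp [h.right.orthogonal _ _ hb]
    · simp [h.left.orthogonal _ _ ha]
  · simp

theorem integral_prodComb_mul_of_forall_ne (h : ProductSystem μX μY pX pY j₀ k₀ a b)
    (ε : ι → ℝ) {j : J} {k : K} (hjk : ∀ i, ¬ (a i = j ∧ b i = k)) :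
    ∫ z, prodComb pX pY a b ε z * (pX j z.1 * pY k z.2) ∂(μX.prod μY) = 0 := by
  rw [h.integral_prodComb_mul]
  refine Finset.sum_eq_zero fun i _ => ?_
  by_cases ha : a i = j
  · have hb : b i ≠ k := fun hb => hjk i ⟨ha, hb⟩
    simp [h.right.orthogonal _ _ hb]
  · simp [h.left.orthogonal _ _ ha]

theorem integrable_prodComb_mul_prodComb (h : ProductSystem μX μY pX pY j₀ k₀ a b)
    (ε ε' : ι → ℝ) :
    Integrable (fun z => prodComb pX pY a b ε z * prodComb pX pY a b ε' z) (μX.prod μY) := by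
  have : (fun z => prodComb pX pY a b ε z * prodComb pX pY a b ε' z) = fun z =>
      ∑ i, ε' i * (prodComb pX pY a b ε z * (pX (a i) z.1 * pY (b i) z.2)) := by
    ext z
    conv_lhs => rw [prodComb.eq_def pX pY a b ε', Finset.mul_sum]
    exact Finset.sum_congr rfl fun i _ => by ring
  rw [this]
  exact integrable_finsetSum _ fun i _ => (h.integrable_prodComb_mul ε _ _).const_mul _

theorem integral_prodComb_mul_prodComb (h : ProductSystem μX μY pX pY j₀ k₀ a b)
    (ε ε' : ι → ℝ) :
    ∫ z, prodComb pX pY a b ε z * prodComb pX pY a b ε' z ∂(μX.prod μY) =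
      ∑ i, ε i * ε' i := by
  have : (fun z => prodComb pX pY a b ε z * prodComb pX pY a b ε' z) = fun z =>
      ∑ i, ε' i * (prodComb pX pY a b ε z * (pX (a i) z.1 * pY (b i) z.2)) := by
    ext z
    conv_lhs => rw [prodComb.eq_def pX pY a b ε', Finset.mul_sum]
    exact Finset.sum_congr rfl fun i _ => by ring
  rw [this, integral_finsetSum _ fun i _ => (h.integrable_prodComb_mul ε _ _).const_mul _]
  simp_rw [integral_const_mul, h.integral_prodComb_mul_self, mul_comm]

theorem integral_one_add_mul (h : ProductSystem μX μY pX pY j₀ k₀ a b) (δ : ℝ) (ε : ι → ℝ) :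
    ∫ z, (1 + δ * prodComb pX pY a b ε z) ∂(μX.prod μY) = 1 := by
  rw [integral_add (integrable_const _) ((h.integrable_prodComb ε).const_mul δ),
    integral_const_mul, h.integral_prodComb]
  simp

theorem integral_one_add_mul_one_add (h : ProductSystem μX μY pX pY j₀ k₀ a b) (δ : ℝ)
    (ε ε' : ι → ℝ) :
    ∫ z, (1 + δ * prodComb pX pY a b ε z) * (1 + δ * prodComb pX pY a b ε' z) ∂(μX.prod μY) =
      1 + δ ^ 2 * ∑ i, ε i * ε' i := by
  have : (fun z => (1 + δ * prodComb pX pY a b ε z) * (1 + δ * prodComb pX pY a b ε' z)) =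
      fun z => (1 + δ * prodComb pX pY a b ε z) + (δ * prodComb pX pY a b ε' z +
        δ ^ 2 * (prodComb pX pY a b ε z * prodComb pX pY a b ε' z)) := by
    ext z; ring
  have i0 : Integrable (fun z => 1 + δ * prodComb pX pY a b ε z) (μX.prod μY) :=
    (integrable_const _).add ((h.integrable_prodComb ε).const_mul δ)
  have i1 := (h.integrable_prodComb ε').const_mul δ
  have i2 := (h.integrable_prodComb_mul_prodComb ε ε').const_mul (δ ^ 2)
  have i12 : Integrable (fun z => δ * prodComb pX pY a b ε' z +
      δ ^ 2 * (prodComb pX pY a b ε z * prodComb pX pY a b ε' z)) (μX.prod μY) := i1.add i2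
  rw [this, integral_add i0 i12, integral_add i1 i2, h.integral_one_add_mul, integral_const_mul,
    integral_const_mul, h.integral_prodComb, h.integral_prodComb_mul_prodComb]
  ring

/-- Every second factor is orthogonal to the constant, so the perturbation disappears at each `x`,
not merely almost everywhere; the supremum bounds on the marginals need this. -/
theorem marginalX_one_add (h : ProductSystem μX μY pX pY j₀ k₀ a b) (δ : ℝ) (ε : ι → ℝ)
    (x : X) : marginalX μY (fun z => 1 + δ * prodComb pX pY a b ε z) x = 1 := by
  have hi : ∀ i, Integrable (fun y => pY (b i) y) μY := fun i =>
    integrable_of_abs_le (h.right.measurable _) (h.right.abs_le _)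
  simp only [marginalX, prodComb]
  rw [integral_add (integrable_const _) ((integrable_finsetSum _ fun i _ =>
    ((hi i).const_mul _).const_mul _).const_mul δ), integral_const_mul,
    integral_finsetSum _ fun i _ => ((hi i).const_mul _).const_mul _]
  simp_rw [integral_const_mul, h.right.integral_eq_zero (h.right_ne _)]
  simp

theorem marginalY_one_add (h : ProductSystem μX μY pX pY j₀ k₀ a b) (δ : ℝ) (ε : ι → ℝ)
    (y : Y) : marginalY μX (fun z => 1 + δ * prodComb pX pY a b ε z) y = 1 := by
  have hi : ∀ i, Integrable (fun x => pX (a i) x) μX := fun i =>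
    integrable_of_abs_le (h.left.measurable _) (h.left.abs_le _)
  simp only [marginalY, prodComb]
  rw [integral_add (integrable_const _) ((integrable_finsetSum _ fun i _ =>
    ((hi i).mul_const _).const_mul _).const_mul δ), integral_const_mul,
    integral_finsetSum _ fun i _ => ((hi i).mul_const _).const_mul _]
  simp_rw [integral_const_mul, integral_mul_const, h.left.integral_eq_zero (h.left_ne _)]
  simp

theorem dependence_one_add (h : ProductSystem μX μY pX pY j₀ k₀ a b) (δ : ℝ) (ε : ι → ℝ) :
    dependence μX μY (fun z => 1 + δ * prodComb pX pY a b ε z) =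
      δ ^ 2 * ∑ i, ε i ^ 2 := by
  simp only [dependence, h.marginalX_one_add, h.marginalY_one_add, sq (ε _)]
  rw [← h.integral_prodComb_mul_prodComb ε ε, ← integral_const_mul]
  exact integral_congr_ae (Filter.Eventually.of_forall fun z => by ring)

/-- With uniform marginals, the product of the marginal coefficients is exactly the contribution of
the constant `1` to the joint coefficient, and the two cancel. -/
theorem coeff_sub_one_add (h : ProductSystem μX μY pX pY j₀ k₀ a b) (δ : ℝ) (ε : ι → ℝ)
    (j : J) (k : K) :
    coeff μX μY pX pY (fun z => 1 + δ * prodComb pX pY a b ε z) j k -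
      coeffX μX μY pX (fun z => 1 + δ * prodComb pX pY a b ε z) j *
        coeffY μX μY pY (fun z => 1 + δ * prodComb pX pY a b ε z) k =
      δ * ∫ z, prodComb pX pY a b ε z * (pX j z.1 * pY k z.2) ∂(μX.prod μY) := by
  simp only [coeff, coeffX, coeffY, h.marginalX_one_add, h.marginalY_one_add, one_mul, add_mul,
    mul_assoc δ]
  rw [integral_add (h.integrable_mul j k) ((h.integrable_prodComb_mul ε j k).const_mul δ),
    integral_const_mul, integral_prod_mul]
  ring

theorem smoothness_one_add (h : ProductSystem μX μY pX pY j₀ k₀ a b) (θ : J → K → ℝ≥0∞)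
    (δ : ℝ) (ε : ι → ℝ) :
    smoothness μX μY pX pY θ (fun z => 1 + δ * prodComb pX pY a b ε z) =
      ∑ i, θ (a i) (b i) ^ 2 * ENNReal.ofReal ((δ * ε i) ^ 2) := by
  classical
  -- Off the system the coefficient is zero, so infinite weights there do no harm. Writing each term
  -- as a finite sum of point masses, by injectivity of the pairs, allows the sums to be exchanged.
  have hterm : ∀ j k, θ j k ^ 2 * ENNReal.ofReal
      ((coeff μX μY pX pY (fun z => 1 + δ * prodComb pX pY a b ε z) j k -
      coeffX μX μY pX (fun z => 1 + δ * prodComb pX pY a b ε z) j *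
        coeffY μX μY pY (fun z => 1 + δ * prodComb pX pY a b ε z) k) ^ 2) =
      ∑ i, if j = a i then
        (if k = b i then θ (a i) (b i) ^ 2 * ENNReal.ofReal ((δ * ε i) ^ 2) else 0) else 0 := by
    intro j k
    rw [h.coeff_sub_one_add]
    by_cases hjk : ∃ i, a i = j ∧ b i = k
    · obtain ⟨i, rfl, rfl⟩ := hjk
      rw [h.integral_prodComb_mul_self, Finset.sum_eq_single i]
      · simp
      · intro i' _ hi
        by_cases ha : a i = a i'
        · have hb : b i ≠ b i' := fun hb => hi (h.inj _ _ ha hb).symm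
          simp [hb]
        · simp [ha]
      · simp
    · push Not at hjk
      rw [h.integral_prodComb_mul_of_forall_ne ε fun i hi => hjk i hi.1 hi.2,
        Finset.sum_eq_zero fun i _ => ?_]
      · simp
      · by_cases ha : j = a i
        · rw [if_pos ha, if_neg fun hb => hjk i ha.symm hb.symm]
        · rw [if_neg ha]
  simp only [smoothness, hterm]
  simp_rw [Summable.tsum_finsetSum fun _ _ => ENNReal.summable]
  refine Finset.sum_congr rfl fun i _ => ?_
  rw [tsum_eq_single (a i) fun j hj => by simp [hj],
    tsum_eq_single (b i) fun k hk => by simp [hk]]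
  simp

theorem one_add_mem_alternatives (h : ProductSystem μX μY pX pY j₀ k₀ a b)
    {θ : J → K → ℝ≥0∞} {δ r A ρ Θ τ : ℝ} {ε : ι → ℝ} (hε : ∀ i, ε i ^ 2 = 1)
    (hΘ0 : 0 ≤ Θ) (hΘ : ∀ i, θ (a i) (b i) ≤ ENNReal.ofReal Θ)
    (hr : Fintype.card ι * (Θ * δ) ^ 2 ≤ r ^ 2) (hρ : ρ ^ 2 ≤ δ ^ 2 * Fintype.card ι)
    (hτ : ∀ z, |δ * prodComb pX pY a b ε z| ≤ τ) (hτ1 : τ ≤ 1) (hτA : 1 + τ ≤ A) :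
    (fun z => 1 + δ * prodComb pX pY a b ε z) ∈ alternatives μX μY pX pY θ r A ρ := by
  have hA : ∀ z, |1 + δ * prodComb pX pY a b ε z| ≤ A := fun z =>
    (abs_add_le _ _).trans (by rw [abs_one]; linarith [hτ z])
  have hm : Measurable fun z => 1 + δ * prodComb pX pY a b ε z :=
    measurable_const.add ((h.measurable_prodComb ε).const_mul δ)
  have h1A : 1 ≤ A := by
    have : Nonempty (X × Y) := nonempty_of_isProbabilityMeasure (μX.prod μY)
    obtain ⟨z⟩ := this
    linarith [(abs_nonneg _).trans (hτ z)]
  refine ⟨⟨hm, MemLp.of_bound hm.aestronglyMeasurable A (Filter.Eventually.of_forall hA),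
    Filter.Eventually.of_forall fun z => ?_, h.integral_one_add_mul δ ε⟩, ?_, ?_, hA, ?_, ?_⟩
  · linarith [(abs_le.1 (hτ z)).1]
  · rw [h.dependence_one_add]
    simpa [hε] using hρ
  · rw [h.smoothness_one_add]
    calc ∑ i, θ (a i) (b i) ^ 2 * ENNReal.ofReal ((δ * ε i) ^ 2)
        ≤ ∑ _i : ι, ENNReal.ofReal ((Θ * δ) ^ 2) := by
          refine Finset.sum_le_sum fun i _ => ?_
          rw [mul_pow, hε, mul_one, mul_pow, ENNReal.ofReal_mul (sq_nonneg Θ),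
            ENNReal.ofReal_pow hΘ0]
          gcongr
          exact hΘ i
      _ = ENNReal.ofReal (Fintype.card ι * (Θ * δ) ^ 2) := by
          rw [Finset.sum_const, Finset.card_univ, nsmul_eq_mul,
            ENNReal.ofReal_mul (Nat.cast_nonneg _), ENNReal.ofReal_natCast]
      _ ≤ ENNReal.ofReal (r ^ 2) := ENNReal.ofReal_le_ofReal hr
  · intro x; rw [h.marginalX_one_add]; simpa using h1A
  · intro y; rw [h.marginalY_one_add]; simpa using h1A

end ProductSystem

end Perturbation

/-! ### Orthonormality and Lipschitz bounds for the Fourier functions; the grid. -/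

section Fourier

variable {d : ℕ} {M : Set (Fin d → ℤ)}

/-- The phase `2π m·x + c`. -/
def phase (m : Fin d → ℤ) (c : ℝ) (x : Cube d) : ℝ := 2 * Real.pi * (∑ l, m l * (x l : ℝ)) + c

theorem continuous_phase (m : Fin d → ℤ) (c : ℝ) : Continuous (phase m c) := by
  unfold phase
  fun_prop

/-- The index `a` only shifts the phase by aπ/2, so cosines and sines are treated together. -/
theorem fourierFun_eq_cos (j : FourierIndex M) (hj : j.freq ≠ 0) (x : Cube d) :
    fourierFun j x = √2 * Real.cos (phase j.freq ((j.1.1 : ℕ) * Real.pi / 2) x) := by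
  rw [fourierFun, if_neg hj, ← Complex.exp_sum, ← Complex.exp_add]
  have : -((j.1.1 : ℕ) : ℂ) * Real.pi * Complex.I / 2 +
      ∑ l, -2 * Real.pi * Complex.I * (j.freq l : ℂ) * ((x l : ℝ) : ℂ) =
      ((-phase j.freq ((j.1.1 : ℕ) * Real.pi / 2) x : ℝ) : ℂ) * Complex.I := by
    simp only [phase]
    push_cast
    rw [Finset.mul_sum, neg_add, add_mul, ← Finset.sum_neg_distrib, Finset.sum_mul, add_comm]
    congr 1
    · exact Finset.sum_congr rfl fun l _ => by ring
    · ring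
  rw [this, Complex.exp_ofReal_mul_I_re, Real.cos_neg]

theorem integral_unitInterval_exp (m : ℤ) :
    ∫ x : unitInterval, Complex.exp (2 * Real.pi * Complex.I * m * ((x : ℝ) : ℂ)) =
      if m = 0 then 1 else 0 := by
  have h : ∫ x : unitInterval, Complex.exp (2 * Real.pi * Complex.I * m * ((x : ℝ) : ℂ)) =
      ∫ x in (0 : ℝ)..1, Complex.exp (2 * Real.pi * Complex.I * m * (x : ℂ)) := by
    rw [intervalIntegral.integral_of_le zero_le_one, ← integral_Icc_eq_integral_Ioc]
    exact integral_subtype_comap measurableSet_Icc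
      (fun x : ℝ => Complex.exp (2 * Real.pi * Complex.I * m * (x : ℂ)))
  rw [h]
  split_ifs with hm
  · simp [hm]
  · have hc : 2 * Real.pi * Complex.I * (m : ℂ) ≠ 0 :=
      mul_ne_zero Complex.two_pi_I_ne_zero (Int.cast_ne_zero.2 hm)
    rw [integral_exp_mul_complex hc]
    have : 2 * (Real.pi : ℂ) * Complex.I * m * ((1 : ℝ) : ℂ) = m * (2 * Real.pi * Complex.I) := by
      push_cast; ring
    rw [this, Complex.exp_int_mul_two_pi_mul_I]
    simp

theorem integral_cos_phase (m : Fin d → ℤ) (c : ℝ) :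
    ∫ x, Real.cos (phase m c x) = if m = 0 then Real.cos c else 0 := by
  have h1 : ∀ x : Cube d, Complex.exp (phase m c x * Complex.I) = Complex.exp (c * Complex.I) *
      ∏ l, Complex.exp (2 * Real.pi * Complex.I * m l * ((x l : ℝ) : ℂ)) := by
    intro x
    rw [← Complex.exp_sum, ← Complex.exp_add]
    congr 1
    simp only [phase]
    push_cast
    rw [add_mul, Finset.mul_sum, Finset.sum_mul, add_comm]
    congr 1
    exact Finset.sum_congr rfl fun l _ => by ring
  have hint : Integrable (fun x : Cube d => Complex.exp (phase m c x * Complex.I)) := by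
    have hc : Continuous fun x : Cube d => Complex.exp (phase m c x * Complex.I) :=
      Complex.continuous_exp.comp ((Complex.continuous_ofReal.comp (continuous_phase m c)).mul
        continuous_const)
    exact Integrable.of_bound hc.aestronglyMeasurable 1
      (Filter.Eventually.of_forall fun x => (Complex.norm_exp_ofReal_mul_I _).le)
  have h2 : ∫ x : Cube d, Complex.exp (phase m c x * Complex.I) =
      if m = 0 then Complex.exp (c * Complex.I) else 0 := by
    simp_rw [h1]
    rw [integral_const_mul, integral_fintype_prod_volume_eq_prod
      (f := fun l (t : unitInterval) =>
        Complex.exp (2 * Real.pi * Complex.I * m l * ((t : ℝ) : ℂ)))]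
    simp_rw [integral_unitInterval_exp]
    split_ifs with hm
    · simp [hm]
    · obtain ⟨l, hl⟩ := Function.ne_iff.1 hm
      rw [Finset.prod_eq_zero (Finset.mem_univ l) (by simpa using hl), mul_zero]
  have h3 : ∫ x : Cube d, Real.cos (phase m c x) =
      (∫ x : Cube d, Complex.exp (phase m c x * Complex.I)).re := by
    have := integral_re hint
    simp only [RCLike.re_eq_complex_re] at this
    rw [← this]
    simp_rw [Complex.exp_ofReal_mul_I_re]
  rw [h3, h2]
  split_ifs
  · exact Complex.exp_ofReal_mul_I_re c
  · simp

theorem integral_cos_phase_mul_cos_phase (m m' : Fin d → ℤ) (c c' : ℝ) :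
    ∫ x, Real.cos (phase m c x) * Real.cos (phase m' c' x) =
      ((if m = m' then Real.cos (c - c') else 0) +
        if m + m' = 0 then Real.cos (c + c') else 0) / 2 := by
  have h : ∀ x, Real.cos (phase m c x) * Real.cos (phase m' c' x) =
      (Real.cos (phase (m - m') (c - c') x) + Real.cos (phase (m + m') (c + c') x)) / 2 := by
    intro x
    have e1 : phase (m - m') (c - c') x = phase m c x - phase m' c' x := by
      simp only [phase, Pi.sub_apply]
      push_cast
      simp only [sub_mul, Finset.sum_sub_distrib]
      ring
    have e2 : phase (m + m') (c + c') x = phase m c x + phase m' c' x := by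
      simp only [phase, Pi.add_apply]
      push_cast
      simp only [add_mul, Finset.sum_add_distrib]
      ring
    rw [e1, e2, Real.cos_sub, Real.cos_add]
    ring
  have hi : ∀ (m : Fin d → ℤ) c, Integrable (fun x => Real.cos (phase m c x)) := fun m c =>
    integrable_of_abs_le (Real.continuous_cos.comp (continuous_phase m c)).measurable
      fun x => Real.abs_cos_le_one _
  simp_rw [h]
  rw [integral_div, integral_add (hi _ _) (hi _ _), integral_cos_phase, integral_cos_phase]
  simp only [sub_eq_zero]

theorem FourierIndex.eq_zero_of_freq_eq_zero {j : FourierIndex M} (hj : j.freq = 0) :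
    j = FourierIndex.zero M := by
  rcases j.2 with h | h
  · exact Subtype.ext h
  · exact absurd hj h.2

theorem isBoundedOrthonormal_fourierFun
    (hM : ∀ m ∈ M, ∀ m' ∈ M, m ≠ 0 → m' ≠ 0 → m + m' ≠ 0) :
    IsBoundedOrthonormal (volume : Measure (Cube d)) (fourierFun (M := M))
      (FourierIndex.zero M) := by
  have hone : ∀ j : FourierIndex M, j.freq = 0 → fourierFun j = fun _ => 1 := fun j hj => by
    ext x; rw [fourierFun, if_pos hj]
  have hcos : ∀ j : FourierIndex M, j.freq ≠ 0 → fourierFun j = fun x =>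
      √2 * Real.cos (phase j.freq ((j.1.1 : ℕ) * Real.pi / 2) x) := fun j hj => by
    ext x; exact fourierFun_eq_cos j hj x
  have hmem : ∀ j : FourierIndex M, j.freq ≠ 0 → j.freq ∈ M := fun j hj => by
    rcases j.2 with h | h
    · exact absurd (congrArg Prod.snd h) hj
    · exact h.1
  have hmul : ∀ j j' : FourierIndex M, j.freq ≠ 0 → j'.freq ≠ 0 →
      ∫ x, fourierFun j x * fourierFun j' x = if j.freq = j'.freq then
        Real.cos ((j.1.1 : ℕ) * Real.pi / 2 - (j'.1.1 : ℕ) * Real.pi / 2) else 0 := by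
    intro j j' hj hj'
    have h : ∀ x, fourierFun j x * fourierFun j' x =
        2 * (Real.cos (phase j.freq ((j.1.1 : ℕ) * Real.pi / 2) x) *
          Real.cos (phase j'.freq ((j'.1.1 : ℕ) * Real.pi / 2) x)) := fun x => by
      rw [hcos j hj, hcos j' hj']
      linear_combination (Real.cos (phase j.freq ((j.1.1 : ℕ) * Real.pi / 2) x) *
          Real.cos (phase j'.freq ((j'.1.1 : ℕ) * Real.pi / 2) x)) *
          Real.mul_self_sqrt (zero_le_two : (0 : ℝ) ≤ 2)
    simp_rw [h]
    -- The hypothesis `hM` removes the resonance m + m' = 0; only equal frequencies can contribute.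
    rw [integral_const_mul, integral_cos_phase_mul_cos_phase,
      if_neg (hM _ (hmem j hj) _ (hmem j' hj') hj hj')]
    ring
  refine ⟨fun j => ?_, fun j x => ?_, fun x => by rw [hone _ rfl], fun j => ?_,
    fun j j' hjj' => ?_⟩
  · by_cases hj : j.freq = 0
    · rw [hone j hj]; exact measurable_const
    · rw [hcos j hj]
      exact (continuous_const.mul (Real.continuous_cos.comp (continuous_phase _ _))).measurable
  · by_cases hj : j.freq = 0
    · rw [hone j hj, abs_one]; exact Real.one_le_sqrt.2 one_le_two
    · rw [hcos j hj, abs_mul, abs_of_nonneg (Real.sqrt_nonneg 2)]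
      exact mul_le_of_le_one_right (Real.sqrt_nonneg 2) (Real.abs_cos_le_one _)
  · by_cases hj : j.freq = 0
    · simp [hone j hj]
    · rw [hmul j j hj hj]; simp
  · by_cases hj : j.freq = 0 <;> by_cases hj' : j'.freq = 0
    · exact absurd ((FourierIndex.eq_zero_of_freq_eq_zero hj).trans
        (FourierIndex.eq_zero_of_freq_eq_zero hj').symm) hjj'
    · simp only [hone j hj, hcos j' hj', one_mul]
      rw [integral_const_mul, integral_cos_phase, if_neg hj', mul_zero]
    · simp only [hone j' hj', hcos j hj, mul_one]
      rw [integral_const_mul, integral_cos_phase, if_neg hj, mul_zero]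
    · rw [hmul j j' hj hj']
      split_ifs with hf
      -- Distinct indices with the same frequency are a cosine and a sine: the phases differ by
      -- ±π/2.
      · have ha : j.1.1 ≠ j'.1.1 := fun ha => hjj' (Subtype.ext (Prod.ext ha hf))
        generalize j.1.1 = u at ha ⊢
        generalize j'.1.1 = v at ha ⊢
        fin_cases u <;> fin_cases v <;> simp_all
      · rfl

theorem abs_fourierFun_sub_le {j : FourierIndex M} (hj : j.freq ≠ 0) {x x' : Cube d} {h : ℝ}
    (hx : ∀ l, |(x l : ℝ) - x' l| ≤ h) :
    |fourierFun j x - fourierFun j x'| ≤ √2 * (2 * Real.pi * (j.size * h)) := by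
  rw [fourierFun_eq_cos j hj, fourierFun_eq_cos j hj, ← mul_sub, abs_mul,
    abs_of_nonneg (Real.sqrt_nonneg 2)]
  refine mul_le_mul_of_nonneg_left ?_ (Real.sqrt_nonneg 2)
  refine (Real.abs_cos_sub_cos_le _ _).trans ?_
  have : phase j.freq ((j.1.1 : ℕ) * Real.pi / 2) x - phase j.freq ((j.1.1 : ℕ) * Real.pi / 2) x'
      = 2 * Real.pi * ∑ l, j.freq l * ((x l : ℝ) - x' l) := by
    simp only [phase, mul_sub, Finset.sum_sub_distrib]
    ring
  rw [this, abs_mul, abs_of_pos Real.two_pi_pos]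
  refine mul_le_mul_of_nonneg_left ?_ Real.two_pi_pos.le
  refine (Finset.abs_sum_le_sum_abs _ _).trans ?_
  rw [FourierIndex.size, Finset.sum_mul]
  refine Finset.sum_le_sum fun l _ => ?_
  rw [abs_mul]
  exact mul_le_mul_of_nonneg_left (hx l) (abs_nonneg _)

/-- The regular grid with mesh `1 / Q` on the unit cube. -/
def gridPoint {d Q : ℕ} (c : Fin d → Fin (Q + 1)) : Cube d := fun l =>
  ⟨(c l : ℕ) / Q, div_nonneg (Nat.cast_nonneg _) (Nat.cast_nonneg _),
    div_le_one_of_le₀ (by exact_mod_cast Nat.lt_succ_iff.1 (c l).2) (Nat.cast_nonneg _)⟩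

theorem exists_gridPoint_close {d Q : ℕ} (hQ : 0 < Q) (x : Cube d) :
    ∃ c : Fin d → Fin (Q + 1), ∀ l, |(x l : ℝ) - gridPoint c l| ≤ 1 / Q := by
  have hQ' : (0 : ℝ) < Q := by exact_mod_cast hQ
  -- The coordinate 1 has index `Q`, which is why each axis carries `Q + 1` grid points.
  refine ⟨fun l => ⟨⌊(x l : ℝ) * Q⌋₊, Nat.lt_succ_iff.2 (Nat.floor_le_of_le ?_)⟩, fun l => ?_⟩
  · exact mul_le_of_le_one_left hQ'.le (x l).2.2
  · have h1 := Nat.floor_le (mul_nonneg (x l).2.1 hQ'.le)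
    have h2 := Nat.lt_floor_add_one ((x l : ℝ) * Q)
    have h3 : (x l : ℝ) - (⌊(x l : ℝ) * Q⌋₊ : ℝ) / Q =
        ((x l : ℝ) * Q - ⌊(x l : ℝ) * Q⌋₊) / Q := by field_simp
    simp only [gridPoint]
    rw [h3, abs_of_nonneg (div_nonneg (sub_nonneg.2 h1) hQ'.le)]
    gcongr
    linarith

/-- The cosine with frequency vector `c + (1, …, 1)`. -/
def cosIndex {d L : ℕ} (hd : 1 ≤ d) {M : Set (Fin d → ℤ)} (hM : nonnegFreq d ⊆ M)
    (c : Fin d → Fin L) : FourierIndex M :=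
  ⟨(0, fun l => (c l : ℕ) + 1), Or.inr ⟨hM fun l => by positivity,
    fun h => by have := congrFun h ⟨0, hd⟩; simp only [Pi.zero_apply] at this; omega⟩⟩

theorem cosIndex_freq_ne {d L : ℕ} (hd : 1 ≤ d) {M : Set (Fin d → ℤ)} (hM : nonnegFreq d ⊆ M)
    (c : Fin d → Fin L) : (cosIndex hd hM c).freq ≠ 0 := fun h => by
  have := congrFun h ⟨0, hd⟩
  simp only [cosIndex, FourierIndex.freq, Pi.zero_apply] at this
  omega

theorem cosIndex_injective {d L : ℕ} (hd : 1 ≤ d) {M : Set (Fin d → ℤ)} (hM : nonnegFreq d ⊆ M) :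
    Function.Injective (cosIndex (L := L) hd hM) := fun c c' h => by
  have h2 : (cosIndex hd hM c).freq = (cosIndex hd hM c').freq := congrArg _ h
  ext l
  have := congrFun h2 l
  simp only [cosIndex, FourierIndex.freq] at this
  omega

theorem cosIndex_size_le {d L : ℕ} (hd : 1 ≤ d) {M : Set (Fin d → ℤ)} (hM : nonnegFreq d ⊆ M)
    (c : Fin d → Fin L) : (cosIndex hd hM c).size ≤ d * L := by
  calc (cosIndex hd hM c).size ≤ ∑ _l : Fin d, (L : ℝ) := by
        refine Finset.sum_le_sum fun l _ => ?_
        have : ((c l : ℕ) : ℝ) + 1 ≤ L := by exact_mod_cast (c l).2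
        simp only [cosIndex, FourierIndex.freq]
        push_cast
        rwa [abs_of_nonneg (by positivity)]
    _ = d * L := by simp

theorem size_nonneg (j : FourierIndex M) : 0 ≤ j.size :=
  Finset.sum_nonneg fun _ _ => abs_nonneg _

theorem add_ne_zero_of_mem_nonnegFreq {m m' : Fin d → ℤ} (hm : m ∈ nonnegFreq d)
    (hm' : m' ∈ nonnegFreq d) (h : m ≠ 0) : m + m' ≠ 0 := fun h0 => h <| by
  ext l
  have h1 := congrFun h0 l
  have h2 := hm l
  have h3 := hm' l
  simp only [Pi.add_apply, Pi.zero_apply] at h1 ⊢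
  omega

/-- This lets one family of cosines with non-negative frequencies serve both choices of frequency
sets. -/
theorem nonnegFreq_subset_halfFreq : nonnegFreq d ⊆ halfFreq d := by
  intro m hm
  by_cases h : m = 0
  · exact Or.inl h
  · right
    obtain ⟨i, hi⟩ := Function.ne_iff.1 h
    have hne : (Finset.univ.filter fun l => m l ≠ 0).Nonempty := ⟨i, by simpa using hi⟩
    refine ⟨Finset.min' _ hne, ?_, fun l hl => ?_⟩
    · have := (Finset.mem_filter.1 (Finset.min'_mem _ hne)).2
      exact lt_of_le_of_ne (hm _) this.symm
    · by_contra hl0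
      exact absurd (Finset.min'_le _ l (by simpa using hl0)) (not_le.2 hl)

/-- At the smaller of the two leading positions, the sum has a positive entry. -/
theorem add_ne_zero_of_mem_halfFreq {m m' : Fin d → ℤ} (hm : m ∈ halfFreq d)
    (hm' : m' ∈ halfFreq d) (h : m ≠ 0) (h' : m' ≠ 0) : m + m' ≠ 0 := fun h0 => by
  obtain ⟨i, hi, hil⟩ := hm.resolve_left h
  obtain ⟨i', hi', hil'⟩ := hm'.resolve_left h'
  have e1 := congrFun h0 i
  have e2 := congrFun h0 i'
  simp only [Pi.add_apply, Pi.zero_apply] at e1 e2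
  rcases lt_trichotomy i i' with hlt | heq | hlt
  · have := hil' i hlt; omega
  · subst heq; omega
  · have := hil i' hlt; omega

end Fourier

/-! ### Lower bounds for the risk with free parameters. -/

section Risk

theorem densityLaw_one {Z : Type*} [MeasurableSpace Z] (μ : Measure Z) :
    densityLaw μ (fun _ => (1 : ℝ)) = μ := by
  simp [densityLaw]

theorem ProductSystem.le_simpleRisk {X Y J K ι γ : Type*} [MeasurableSpace X] [MeasurableSpace Y]
    [Fintype ι] [Nonempty ι] [Fintype γ] {μX : Measure X} {μY : Measure Y}
    [IsProbabilityMeasure μX] [IsProbabilityMeasure μY] {pX : J → X → ℝ} {pY : K → Y → ℝ}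
    {j₀ : J} {k₀ : K} {a : ι → J} {b : ι → K} (h : ProductSystem μX μY pX pY j₀ k₀ a b)
    (net : γ → X × Y) {θ : J → K → ℝ≥0∞} {n : ℕ} {r A ρ Θ δ τ η κ Δ : ℝ}
    (hΘ0 : 0 ≤ Θ) (hΘ : ∀ i, θ (a i) (b i) ≤ ENNReal.ofReal Θ)
    (hδ : 0 < δ) (hτ0 : 0 ≤ τ) (hτ1 : τ ≤ 1) (hτA : 1 + τ ≤ A) (hη : η < 1) (hκ : 0 < κ)
    (hr : Fintype.card ι * (Θ * δ) ^ 2 ≤ r ^ 2) (hρ : ρ ^ 2 ≤ δ ^ 2 * Fintype.card ι)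
    (hnet : ∀ z : X × Y, ∃ c, ∀ i, |pX (a i) z.1 * pY (b i) z.2 -
      pX (a i) (net c).1 * pY (b i) (net c).2| ≤ Δ)
    (hΔ : Fintype.card ι * Δ ≤ τ / δ / 2)
    (hunion : Fintype.card γ *
      (2 * Real.exp (-((τ / δ / 2) ^ 2 / (2 * (4 * Fintype.card ι))))) ≤ η)
    (hχ : Real.exp ((n * δ ^ 2) ^ 2 * Fintype.card ι / 2) ≤ (1 + κ ^ 2) * (1 - η) ^ 2) :
    ENNReal.ofReal (1 - κ) ≤ simpleRisk μX μY pX pY j₀ k₀ n θ r A ρ := by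
  classical
  set N := Fintype.card ι with hN
  let good : (ι → ℝ) → Prop := fun ε => ∀ z, |prodComb pX pY a b ε z| ≤ τ / δ
  let G := (signs ι).filter good
  let f : (ι → ℝ) → X × Y → ℝ := fun ε z => 1 + δ * prodComb pX pY a b ε z
  have hbad : (((signs ι).filter fun ε => ¬ good ε).card : ℝ) ≤ 2 ^ N * η := by
    refine (card_signs_sup_gt_le (fun i (z : X × Y) => pX (a i) z.1 * pY (b i) z.2)
      (fun i z => h.abs_mul_le _ _ z) net (by positivity) hnet hΔ
      (Finset.filter_subset _ _) fun ε hε => ?_).trans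
      (mul_le_mul_of_nonneg_left hunion (by positivity))
    have := (Finset.mem_filter.1 hε).2
    simpa only [good, not_forall, not_le, prodComb] using this
  have hG : 2 ^ N * (1 - η) ≤ (G.card : ℝ) := by
    have h1 := Finset.card_filter_add_card_filter_not (s := signs ι) good
    have h2 : (G.card : ℝ) + ((signs ι).filter fun ε => ¬ good ε).card = 2 ^ N := by
      rw [← card_signs]; exact_mod_cast h1
    linarith
  have hGpos : (0 : ℝ) < G.card := lt_of_lt_of_le (mul_pos (by positivity) (sub_pos.2 hη)) hG
  have hsup : ∀ ε ∈ G, ∀ z, |δ * prodComb pX pY a b ε z| ≤ τ := fun ε hε z => by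
    have := (Finset.mem_filter.1 hε).2 z
    rw [abs_mul, abs_of_pos hδ, mul_comm]
    exact (le_div_iff₀ hδ).1 this
  have hf0 : ∀ ε ∈ G, ∀ z, 0 ≤ f ε z := fun ε hε z => by
    have := (abs_le.1 (hsup ε hε z)).1
    simp only [f]
    linarith
  -- At level 1 the size constraint holds for every measurable function with values in [0, 1].
  refine le_iInf₂ fun ψ hψ => ?_
  have hnull : densityLaw (μX.prod μY) (fun z => pX j₀ z.1 * pY k₀ z.2) = μX.prod μY := by
    simp_rw [h.left.one, h.right.one, mul_one]
    exact densityLaw_one _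
  rw [hnull]
  refine le_risk_of_chiSq (C := 2) hκ G (Finset.card_pos.1 (by exact_mod_cast hGpos)) f
    (fun ε _ => measurable_const.add ((h.measurable_prodComb ε).const_mul δ)) hf0
    (fun ε hε z => ?_) (fun ε _ => h.integral_one_add_mul δ ε) ?_ hψ.1 hψ.2.1 fun ε hε => ?_
  · have := (abs_le.1 (hsup ε hε z)).2
    simp only [f]
    linarith
  · calc ∑ ε ∈ G, ∑ ε' ∈ G, (∫ z, f ε z * f ε' z ∂(μX.prod μY)) ^ n
        ≤ ∑ ε ∈ G, ∑ ε' ∈ G, Real.exp (n * δ ^ 2 * ∑ i, ε i * ε' i) := by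
          refine Finset.sum_le_sum fun ε hε => Finset.sum_le_sum fun ε' hε' => ?_
          -- Non-negativity, available on `G` only, is what permits raising 1 + x ≤ exp x to the
          -- n-th power.
          have h0 : 0 ≤ ∫ z, f ε z * f ε' z ∂(μX.prod μY) :=
            integral_nonneg fun z => mul_nonneg (hf0 ε hε z) (hf0 ε' hε' z)
          have h1 : ∫ z, f ε z * f ε' z ∂(μX.prod μY) ≤
              Real.exp (δ ^ 2 * ∑ i, ε i * ε' i) := by
            rw [h.integral_one_add_mul_one_add, add_comm]
            exact Real.add_one_le_exp _
          calc _ ≤ Real.exp (δ ^ 2 * ∑ i, ε i * ε' i) ^ n := pow_le_pow_left₀ h0 h1 n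
            _ = _ := by rw [← Real.exp_nat_mul, mul_assoc]
      -- The exponentials are positive, so the sums may be extended to all signs, where they
      -- factorise.
      _ ≤ ∑ ε ∈ signs ι, ∑ ε' ∈ signs ι, Real.exp (n * δ ^ 2 * ∑ i, ε i * ε' i) := by
          refine (Finset.sum_le_sum fun ε _ => Finset.sum_le_sum_of_subset_of_nonneg
            (Finset.filter_subset _ _) fun _ _ _ => (Real.exp_pos _).le).trans ?_
          exact Finset.sum_le_sum_of_subset_of_nonneg (Finset.filter_subset _ _)
            fun _ _ _ => Finset.sum_nonneg fun _ _ => (Real.exp_pos _).le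
      _ ≤ (2 ^ N) ^ 2 * Real.exp ((n * δ ^ 2) ^ 2 * N / 2) := sum_signs_sum_signs_exp_le _
      _ ≤ (2 ^ N) ^ 2 * ((1 + κ ^ 2) * (1 - η) ^ 2) := by gcongr
      _ = (1 + κ ^ 2) * (2 ^ N * (1 - η)) ^ 2 := by ring
      _ ≤ (1 + κ ^ 2) * (G.card : ℝ) ^ 2 := by
          have : 0 ≤ 2 ^ N * (1 - η) := mul_nonneg (by positivity) (sub_nonneg.2 hη.le)
          gcongr
  · have hmem : f ε ∈ alternatives μX μY pX pY θ r A ρ :=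
      h.one_add_mem_alternatives (sq_of_mem_signs (Finset.mem_filter.1 hε).1) hΘ0 hΘ hr hρ
        (hsup ε hε) hτ1 hτA
    exact le_iSup₂ (f := fun g (_ : g ∈ alternatives μX μY pX pY θ r A ρ) =>
      ∫⁻ w, ENNReal.ofReal (1 - ψ w) ∂(iidLaw (densityLaw (μX.prod μY) g) n)) (f ε) hmem

theorem le_simpleRisk_fourier {dX dY : ℕ} (hdX : 1 ≤ dX) (hdY : 1 ≤ dY)
    {MX : Set (Fin dX → ℤ)} {MY : Set (Fin dY → ℤ)}
    (hMX : nonnegFreq dX ⊆ MX) (hMY : nonnegFreq dY ⊆ MY)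
    (hX : ∀ m ∈ MX, ∀ m' ∈ MX, m ≠ 0 → m' ≠ 0 → m + m' ≠ 0)
    (hY : ∀ m ∈ MY, ∀ m' ∈ MY, m ≠ 0 → m' ≠ 0 → m + m' ≠ 0)
    {LX LY Q n : ℕ} (hLX : 0 < LX) (hLY : 0 < LY) (hQ : 0 < Q)
    {sX sY r A ρ Θ δ τ η κ N : ℝ} (hsX : 0 < sX) (hsY : 0 < sY)
    (hN : N = (LX : ℝ) ^ dX * (LY : ℝ) ^ dY)
    (hΘX : ((dX : ℝ) * LX) ^ sX ≤ Θ) (hΘY : ((dY : ℝ) * LY) ^ sY ≤ Θ)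
    (hδ : 0 < δ) (hτ0 : 0 ≤ τ) (hτ1 : τ ≤ 1) (hτA : 1 + τ ≤ A) (hη : η < 1) (hκ : 0 < κ)
    (hr : N * (Θ * δ) ^ 2 ≤ r ^ 2) (hρ : ρ ^ 2 ≤ δ ^ 2 * N)
    (hΔ : N * (4 * Real.pi * (dX * LX + dY * LY) / Q) ≤ τ / δ / 2)
    (hunion : (Q + 1 : ℝ) ^ (dX + dY) *
      (2 * Real.exp (-((τ / δ / 2) ^ 2 / (2 * (4 * N))))) ≤ η)
    (hχ : Real.exp ((n * δ ^ 2) ^ 2 * N / 2) ≤ (1 + κ ^ 2) * (1 - η) ^ 2) :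
    ENNReal.ofReal (1 - κ) ≤ simpleRisk (volume : Measure (Cube dX)) (volume : Measure (Cube dY))
      (fourierFun (M := MX)) (fourierFun (M := MY)) (FourierIndex.zero MX) (FourierIndex.zero MY)
      n (sobolevWeight sX sY) r A ρ := by
  have : NeZero LX := ⟨hLX.ne'⟩
  have : NeZero LY := ⟨hLY.ne'⟩
  let a : (Fin dX → Fin LX) × (Fin dY → Fin LY) → FourierIndex MX :=
    fun i => cosIndex hdX hMX i.1
  let b : (Fin dX → Fin LX) × (Fin dY → Fin LY) → FourierIndex MY :=
    fun i => cosIndex hdY hMY i.2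
  have h : ProductSystem (volume : Measure (Cube dX)) (volume : Measure (Cube dY))
      (fourierFun (M := MX)) (fourierFun (M := MY)) (FourierIndex.zero MX)
      (FourierIndex.zero MY) a b :=
    { left := isBoundedOrthonormal_fourierFun hX
      right := isBoundedOrthonormal_fourierFun hY
      inj := fun i i' h h' => Prod.ext (cosIndex_injective hdX hMX h)
        (cosIndex_injective hdY hMY h')
      left_ne := fun i hi => cosIndex_freq_ne hdX hMX i.1 (congrArg FourierIndex.freq hi)
      right_ne := fun i hi => cosIndex_freq_ne hdY hMY i.2 (congrArg FourierIndex.freq hi) }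
  have hcard : ((Fintype.card ((Fin dX → Fin LX) × (Fin dY → Fin LY)) : ℕ) : ℝ) = N := by
    simp [hN]
  have hcard' : ((Fintype.card ((Fin dX → Fin (Q + 1)) × (Fin dY → Fin (Q + 1))) : ℕ) : ℝ) =
      (Q + 1 : ℝ) ^ (dX + dY) := by
    simp [pow_add]
  have hΘ0 : 0 ≤ Θ := le_trans (by positivity) hΘX
  refine h.le_simpleRisk (η := η) (δ := δ) (Θ := Θ) (τ := τ)
    (Δ := 4 * Real.pi * (dX * LX + dY * LY) / Q)
    (fun c : (Fin dX → Fin (Q + 1)) × (Fin dY → Fin (Q + 1)) => (gridPoint c.1, gridPoint c.2))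
    hΘ0 (fun i => ?_) hδ hτ0 hτ1 hτA hη hκ (by rwa [hcard]) (by rwa [hcard]) (fun z => ?_)
    (by rwa [hcard]) (by rwa [hcard, hcard']) (by rwa [hcard])
  · rw [sobolevWeight, if_neg (not_or.2 ⟨cosIndex_freq_ne hdX hMX i.1,
      cosIndex_freq_ne hdY hMY i.2⟩)]
    refine ENNReal.ofReal_le_ofReal (max_le (le_trans ?_ hΘX) (le_trans ?_ hΘY))
    · exact Real.rpow_le_rpow (size_nonneg _) (cosIndex_size_le hdX hMX i.1) hsX.le
    · exact Real.rpow_le_rpow (size_nonneg _) (cosIndex_size_le hdY hMY i.2) hsY.le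
  · obtain ⟨cX, hcX⟩ := exists_gridPoint_close hQ z.1
    obtain ⟨cY, hcY⟩ := exists_gridPoint_close hQ z.2
    refine ⟨(cX, cY), fun i => ?_⟩
    have hQ0 : (0 : ℝ) < Q := by exact_mod_cast hQ
    have h1 := abs_fourierFun_sub_le (cosIndex_freq_ne hdX hMX i.1) hcX
    have h2 := abs_fourierFun_sub_le (cosIndex_freq_ne hdY hMY i.2) hcY
    have h3 := cosIndex_size_le hdX hMX i.1
    have h4 := cosIndex_size_le hdY hMY i.2
    have h5 : √2 * √2 = (2 : ℝ) := by norm_num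
    -- One factor changes at a time, and the other is bounded by √2.
    have e : fourierFun (a i) z.1 * fourierFun (b i) z.2 -
        fourierFun (a i) (gridPoint cX) * fourierFun (b i) (gridPoint cY) =
        (fourierFun (a i) z.1 - fourierFun (a i) (gridPoint cX)) * fourierFun (b i) z.2 +
        fourierFun (a i) (gridPoint cX) *
          (fourierFun (b i) z.2 - fourierFun (b i) (gridPoint cY)) := by ring
    rw [e]
    refine (abs_add_le _ _).trans ?_
    rw [abs_mul, abs_mul]
    calc |fourierFun (a i) z.1 - fourierFun (a i) (gridPoint cX)| * |fourierFun (b i) z.2| +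
          |fourierFun (a i) (gridPoint cX)| *
            |fourierFun (b i) z.2 - fourierFun (b i) (gridPoint cY)|
        ≤ (√2 * (2 * Real.pi * (dX * LX * (1 / Q)))) * √2 +
          √2 * (√2 * (2 * Real.pi * (dY * LY * (1 / Q)))) := by
          gcongr
          · exact h1.trans (by gcongr)
          · exact h.right.abs_le _ _
          · exact h.left.abs_le _ _
          · exact h2.trans (by gcongr)
      _ = (√2 * √2) * (2 * Real.pi * (dX * LX + dY * LY) / Q) := by ring
      _ = 4 * Real.pi * (dX * LX + dY * LY) / Q := by rw [h5]; ring

end Risk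

/-! ### Identities between the rate, the cut-off and the number of frequencies; calibration. -/

section Rate

variable {dX dY n : ℕ} {sX sY r : ℝ}

theorem effSmoothness_pos (hdX : 1 ≤ dX) (hsX : 0 < sX) (hsY : 0 < sY) :
    0 < effSmoothness dX dY sX sY := by
  have : (0 : ℝ) < dX := by exact_mod_cast hdX
  unfold effSmoothness
  positivity

theorem sobolevRate_pos (hn : 0 < (n : ℝ)) (hr : 0 < r) : 0 < sobolevRate dX dY sX sY n r := by
  unfold sobolevRate
  positivity

/-- The frequency cut-off, as a function of `t = n r²`. -/
def cutoff (dX dY : ℕ) (sX sY t : ℝ) : ℝ :=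
  t ^ (2 * effSmoothness dX dY sX sY / (4 * effSmoothness dX dY sX sY + ((dX : ℝ) + dY)))

theorem sobolevRate_mul_cutoff (hdX : 1 ≤ dX) (hsX : 0 < sX) (hsY : 0 < sY)
    (hn : 0 < (n : ℝ)) (hr : 0 < r) :
    sobolevRate dX dY sX sY n r * cutoff dX dY sX sY (n * r ^ 2) = r := by
  have hs := effSmoothness_pos (dY := dY) hdX hsX hsY
  unfold sobolevRate cutoff
  set s := effSmoothness dX dY sX sY
  set q := 4 * s + ((dX : ℝ) + dY) with hq
  have hq0 : 0 < q := by positivity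
  rw [Real.div_rpow (by positivity) (by positivity), ← Real.rpow_natCast, ← Real.rpow_natCast,
    Real.mul_rpow hn.le (by positivity), ← Real.rpow_mul hr.le, ← Real.rpow_mul hn.le,
    ← Real.rpow_mul hr.le]
  have e : 2 * s * (1 / q) = 2 * s / q := by ring
  rw [e]
  have hne : (n : ℝ) ^ (2 * s / q) ≠ 0 := (Real.rpow_pos_of_pos hn _).ne'
  field_simp
  rw [← Real.rpow_add hr]
  have e2 : ((dX + dY : ℕ) : ℝ) / q + 2 * 2 * s / q = 1 := by
    rw [← add_div, div_eq_one_iff_eq hq0.ne', hq]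
    push_cast
    ring
  push_cast at e2 ⊢
  ring_nf at e2 ⊢
  rw [e2, Real.rpow_one]

/-- The order of the number of frequency pairs up to the cut-off. -/
def numFreq (dX dY : ℕ) (sX sY t : ℝ) : ℝ :=
  t ^ (2 * ((dX : ℝ) + dY) / (4 * effSmoothness dX dY sX sY + ((dX : ℝ) + dY)))

/-- The effective smoothness is defined so that dX/sX + dY/sY = d/s. -/
theorem cutoff_pow_mul_pow (hdX : 1 ≤ dX) (hsX : 0 < sX) (hsY : 0 < sY) {t : ℝ} (ht : 0 < t) :
    (cutoff dX dY sX sY t ^ (1 / sX)) ^ dX * (cutoff dX dY sX sY t ^ (1 / sY)) ^ dY =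
      numFreq dX dY sX sY t := by
  have hs := effSmoothness_pos (dY := dY) hdX hsX hsY
  have hd : (0 : ℝ) < dX := by exact_mod_cast hdX
  have hB : 0 < cutoff dX dY sX sY t := Real.rpow_pos_of_pos ht _
  rw [← Real.rpow_natCast, ← Real.rpow_natCast, ← Real.rpow_mul hB.le, ← Real.rpow_mul hB.le,
    ← Real.rpow_add hB, cutoff, numFreq, ← Real.rpow_mul ht.le]
  congr 1
  have e : 1 / sX * dX + 1 / sY * dY = ((dX : ℝ) + dY) / effSmoothness dX dY sX sY := by
    unfold effSmoothness
    field_simp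
  rw [e]
  field_simp

/-- Multiply by the fourth power of the cut-off B: by RB = r the left side becomes (nr²)², and so
does the right side by adding exponents. -/
theorem sq_mul_sobolevRate_pow (hdX : 1 ≤ dX) (hsX : 0 < sX) (hsY : 0 < sY)
    (hn : 0 < (n : ℝ)) (hr : 0 < r) :
    (n : ℝ) ^ 2 * sobolevRate dX dY sX sY n r ^ 4 = numFreq dX dY sX sY (n * r ^ 2) := by
  have hs := effSmoothness_pos (dY := dY) hdX hsX hsY
  have hT : 0 < (n : ℝ) * r ^ 2 := by positivity
  have hB : 0 < cutoff dX dY sX sY (n * r ^ 2) := Real.rpow_pos_of_pos hT _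
  have h1 := sobolevRate_mul_cutoff (dY := dY) hdX hsX hsY hn hr
  have h2 : ∀ t : ℝ, 0 < t → numFreq dX dY sX sY t * cutoff dX dY sX sY t ^ 4 = t ^ 2 := by
    intro t hT
    rw [cutoff, numFreq, ← Real.rpow_natCast, ← Real.rpow_mul hT.le, ← Real.rpow_add hT,
      ← Real.rpow_natCast]
    congr 1
    push_cast
    field_simp
    ring
  refine mul_right_cancel₀ (pow_pos hB 4).ne' ?_
  rw [h2 _ hT, mul_assoc, ← mul_pow, h1]
  ring

theorem one_le_cutoff (hdX : 1 ≤ dX) (hsX : 0 < sX) (hsY : 0 < sY) {t : ℝ} (ht : 1 ≤ t) :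
    1 ≤ cutoff dX dY sX sY t := by
  have hs := effSmoothness_pos (dY := dY) hdX hsX hsY
  exact Real.one_le_rpow ht (by positivity)

/-- Keeps the grid of polynomial size in nr², so that the union bound costs only a multiple of
log(nr²). -/
theorem numFreq_le_sq (hdX : 1 ≤ dX) (hsX : 0 < sX) (hsY : 0 < sY) {t : ℝ} (ht : 1 ≤ t) :
    numFreq dX dY sX sY t ≤ t ^ 2 := by
  have hs := effSmoothness_pos (dY := dY) hdX hsX hsY
  have hd : (0 : ℝ) < dX := by exact_mod_cast hdX
  rw [← Real.rpow_natCast]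
  refine Real.rpow_le_rpow_of_exponent_le ht ?_
  rw [div_le_iff₀ (by positivity)]
  push_cast
  linarith

theorem floor_bounds {x : ℝ} (hx : 1 ≤ x) :
    0 < ⌊x⌋₊ ∧ (⌊x⌋₊ : ℝ) ≤ x ∧ x ≤ 2 * (⌊x⌋₊ : ℝ) := by
  have h1 : 1 ≤ ⌊x⌋₊ := Nat.le_floor (by simpa using hx)
  have h2 := Nat.lt_floor_add_one x
  have h3 : (1 : ℝ) ≤ (⌊x⌋₊ : ℝ) := by exact_mod_cast h1
  exact ⟨h1, Nat.floor_le (by linarith), by linarith⟩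

/-- Here `η` bounds both the fraction of bad signs and the exponent of the second moment, `k` is the
surplus power of 1/T that absorbs the constants of the union bound, and `c` scales the perturbation.
-/
theorem le_sobolevSeparation (hdX : 1 ≤ dX) (hdY : 1 ≤ dY)
    {MX : Set (Fin dX → ℤ)} {MY : Set (Fin dY → ℤ)}
    (hMX : nonnegFreq dX ⊆ MX) (hMY : nonnegFreq dY ⊆ MY)
    (hX : ∀ m ∈ MX, ∀ m' ∈ MX, m ≠ 0 → m' ≠ 0 → m + m' ≠ 0)
    (hY : ∀ m ∈ MY, ∀ m' ∈ MY, m ≠ 0 → m' ≠ 0 → m + m' ≠ 0)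
    (hsX : 0 < sX) (hsY : 0 < sY) {A γ κ τ η c Cθ : ℝ} {k : ℕ}
    (hγ0 : 0 < γ) (hγκ : γ < 1 - κ) (hκ : 0 < κ) (hτ0 : 0 < τ) (hτ1 : τ ≤ 1) (hτA : 1 + τ ≤ A)
    (hη1 : η < 1) (hηκ : Real.exp η ≤ (1 + κ ^ 2) * (1 - η) ^ 2)
    (hCX : (dX : ℝ) ^ sX ≤ Cθ) (hCY : (dY : ℝ) ^ sY ≤ Cθ)
    (hk : 2 * (64 * (dX + dY) : ℝ) ^ (dX + dY) * (1 / 2) ^ k ≤ η)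
    (hc0 : 0 < c) (hc1 : c ≤ 1) (hcθ : Cθ * c ≤ 1) (hcη : c * 2 ^ (dX + dY) ≤ η)
    (hcτ : 32 * c ^ 2 * (4 * (dX + dY) + k) ≤ τ ^ 2)
    (hr : 0 < r) (hT : 2 ≤ (n : ℝ) * r ^ 2)
    (hrate : sobolevRate dX dY sX sY n r ≤ 1 / √(Real.log ((n : ℝ) * r ^ 2))) :
    ENNReal.ofReal (c * sobolevRate dX dY sX sY n r) ≤
      sobolevSeparation MX MY n γ sX sY r A := by
  have hn : 0 < (n : ℝ) := pos_of_mul_pos_left (by linarith) (sq_nonneg r)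
  have hR := sobolevRate_pos (dX := dX) (dY := dY) (sX := sX) (sY := sY) hn hr
  have hRB := sobolevRate_mul_cutoff (dY := dY) hdX hsX hsY hn hr
  have hR4 := sq_mul_sobolevRate_pow (dY := dY) hdX hsX hsY hn hr
  set T := (n : ℝ) * r ^ 2 with hTdef
  have hB1 := one_le_cutoff (dY := dY) hdX hsX hsY (t := T) (by linarith)
  have hBP := cutoff_pow_mul_pow (dY := dY) hdX hsX hsY (t := T) (by linarith)
  have hPT := numFreq_le_sq (dY := dY) hdX hsX hsY (t := T) (by linarith)
  set R := sobolevRate dX dY sX sY n r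
  set B := cutoff dX dY sX sY T
  set P := numFreq dX dY sX sY T
  have hdX1 : (1 : ℝ) ≤ dX := by exact_mod_cast hdX
  have hdY1 : (1 : ℝ) ≤ dY := by exact_mod_cast hdY
  obtain ⟨hLX0, hLXle, hLXge⟩ := floor_bounds (Real.one_le_rpow hB1 (z := 1 / sX) (by positivity))
  obtain ⟨hLY0, hLYle, hLYge⟩ := floor_bounds (Real.one_le_rpow hB1 (z := 1 / sY) (by positivity))
  set LX := ⌊B ^ (1 / sX)⌋₊
  set LY := ⌊B ^ (1 / sY)⌋₊
  have hLX1 : (1 : ℝ) ≤ LX := by exact_mod_cast hLX0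
  have hLY1 : (1 : ℝ) ≤ LY := by exact_mod_cast hLY0
  obtain ⟨N, hN⟩ : ∃ N : ℕ, N = LX ^ dX * LY ^ dY := ⟨_, rfl⟩
  have hNreal : (N : ℝ) = (LX : ℝ) ^ dX * (LY : ℝ) ^ dY := by rw [hN]; push_cast; rfl
  have hN1 : (1 : ℝ) ≤ N := by
    rw [hNreal]; exact one_le_mul_of_one_le_of_one_le (one_le_pow₀ hLX1) (one_le_pow₀ hLY1)
  have hNP : (N : ℝ) ≤ P := by
    rw [hNreal, ← hBP]; gcongr
  have hPN : P ≤ 2 ^ (dX + dY) * N := by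
    rw [hNreal, ← hBP]
    calc (B ^ (1 / sX)) ^ dX * (B ^ (1 / sY)) ^ dY ≤ (2 * LX) ^ dX * (2 * LY) ^ dY := by
          gcongr
      _ = _ := by ring
  have hLXN : (LX : ℝ) ≤ N := by
    rw [hNreal]
    exact (le_self_pow₀ hLX1 (by omega)).trans
      (le_mul_of_one_le_right (by positivity) (one_le_pow₀ hLY1))
  have hLYN : (LY : ℝ) ≤ N := by
    rw [hNreal]
    exact (le_self_pow₀ hLY1 (by omega)).trans
      (le_mul_of_one_le_left (by positivity) (one_le_pow₀ hLX1))
  have hlog : 1 / 2 ≤ Real.log T :=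
    le_trans (by linarith [Real.log_two_gt_d9]) (Real.log_le_log two_pos hT)
  have hRlog : R ^ 2 * Real.log T ≤ 1 := by
    have hs0 : 0 < √(Real.log T) := Real.sqrt_pos.2 (by linarith)
    have h1 : R * √(Real.log T) ≤ 1 := (le_div_iff₀ hs0).1 hrate
    have h2 : (R * √(Real.log T)) ^ 2 ≤ 1 := pow_le_one₀ (by positivity) h1
    rwa [mul_pow, Real.sq_sqrt (by linarith)] at h2
  set δ := c * R / √N with hδdef
  have hδ : 0 < δ := by positivity
  have hδN : δ ^ 2 * N = (c * R) ^ 2 := by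
    rw [hδdef, div_pow, Real.sq_sqrt (by linarith)]
    field_simp
  -- Since log T ≥ 1/2, the rate condition gives R² ≤ 2, so δ² ≤ 2c². The discretisation step needs
  -- τ/δ ≥ 1.
  have hδτ : δ ≤ τ := by
    have h1 : δ ^ 2 ≤ τ ^ 2 := by
      have h2 : δ ^ 2 ≤ δ ^ 2 * N := le_mul_of_one_le_right (sq_nonneg _) hN1
      have h3 : R ^ 2 ≤ 2 := by
        have := mul_le_mul_of_nonneg_left hlog (sq_nonneg R)
        linarith
      have h4 : c ^ 2 * R ^ 2 ≤ c ^ 2 * 2 := mul_le_mul_of_nonneg_left h3 (sq_nonneg c)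
      have h5 : 32 * c ^ 2 * 4 ≤ 32 * c ^ 2 * (4 * ((dX : ℝ) + dY) + k) := by
        refine mul_le_mul_of_nonneg_left ?_ (by positivity)
        have : (0 : ℝ) ≤ k := Nat.cast_nonneg k
        linarith
      rw [hδN, mul_pow] at h2
      have h6 := h5.trans hcτ
      have h7 := sq_nonneg c
      linarith
    exact (sq_le_sq₀ hδ.le hτ0.le).1 h1
  have hrisk : ∀ ρ, 0 < ρ → ρ ≤ c * R → ENNReal.ofReal (1 - κ) ≤
      simpleRisk (volume : Measure (Cube dX)) (volume : Measure (Cube dY))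
      (fourierFun (M := MX)) (fourierFun (M := MY)) (FourierIndex.zero MX) (FourierIndex.zero MY)
      n (sobolevWeight sX sY) r A ρ := by
    intro ρ hρ0 hρ
    have hD : (0 : ℝ) < (dX : ℝ) + dY := by linarith
    -- As LX, LY ≤ N and π ≤ 4, this `Q` makes the total discretisation error of the N summands at
    -- most 1/2.
    refine le_simpleRisk_fourier hdX hdY hMX hMY hX hY hLX0 hLY0
      (Q := 32 * (dX + dY) * N ^ 2) (N := N) (Θ := Cθ * B) (δ := δ) (τ := τ) (η := η)
      ?_ hsX hsY hNreal ?_ ?_ hδ hτ0.le hτ1 hτA hη1 hκ ?_ ?_ ?_ ?_ ?_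
    · have : 0 < N := by exact_mod_cast (zero_lt_one.trans_le hN1)
      have : 0 < dX + dY := by omega
      positivity
    · rw [Real.mul_rpow (by linarith) (by linarith)]
      refine mul_le_mul hCX ?_ (by positivity) (le_trans (by positivity) hCX)
      calc (LX : ℝ) ^ sX ≤ (B ^ (1 / sX)) ^ sX := by gcongr
        _ = B := by rw [← Real.rpow_mul (by linarith), one_div_mul_cancel hsX.ne', Real.rpow_one]
    · rw [Real.mul_rpow (by linarith) (by linarith)]
      refine mul_le_mul hCY ?_ (by positivity) (le_trans (by positivity) hCY)
      calc (LY : ℝ) ^ sY ≤ (B ^ (1 / sY)) ^ sY := by gcongr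
        _ = B := by rw [← Real.rpow_mul (by linarith), one_div_mul_cancel hsY.ne', Real.rpow_one]
    · have hC0 : 0 ≤ Cθ := le_trans (by positivity) hCX
      calc N * (Cθ * B * δ) ^ 2 = (Cθ * B) ^ 2 * (δ ^ 2 * N) := by ring
        _ = (Cθ * c) ^ 2 * (R * B) ^ 2 := by rw [hδN]; ring
        _ ≤ 1 * r ^ 2 := by
            rw [hRB]
            exact mul_le_mul_of_nonneg_right (pow_le_one₀ (by positivity) hcθ) (sq_nonneg r)
        _ = r ^ 2 := one_mul _
    · rw [hδN]; gcongr
    · have h1 : 1 / 2 ≤ τ / δ / 2 := by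
        have := (one_le_div hδ).2 hδτ
        linarith
      refine le_trans ?_ h1
      push_cast
      rw [← mul_div_assoc, div_le_iff₀ (by positivity)]
      have h2 : (dX : ℝ) * LX + dY * LY ≤ (dX + dY) * N := by
        rw [add_mul]; gcongr
      calc (N : ℝ) * (4 * Real.pi * (dX * LX + dY * LY))
          ≤ N * (4 * 4 * ((dX + dY) * N)) := by
            gcongr
            exact Real.pi_le_four
        _ = 1 / 2 * (32 * (dX + dY) * N ^ 2) := by ring
    -- The grid has at most (64dT⁴)^d points, with d = dX + dY. The power 4d of 1/T cancels T^(4d),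
    -- and the remaining k, with T ≥ 2, beats the constant.
    · have h1 : ((4 * (dX + dY) + k : ℕ) : ℝ) * Real.log T ≤
          (τ / δ / 2) ^ 2 / (2 * (4 * N)) := by
        have e : (τ / δ / 2) ^ 2 / (2 * (4 * N)) = τ ^ 2 / (32 * (δ ^ 2 * N)) := by
          field_simp; ring
        rw [e, hδN, le_div_iff₀ (by positivity)]
        push_cast
        calc (4 * ((dX : ℝ) + dY) + k) * Real.log T * (32 * (c * R) ^ 2)
            = 32 * c ^ 2 * (4 * ((dX : ℝ) + dY) + k) * (R ^ 2 * Real.log T) := by ring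
          _ ≤ 32 * c ^ 2 * (4 * ((dX : ℝ) + dY) + k) * 1 := by gcongr
          _ ≤ τ ^ 2 := by rw [mul_one]; exact hcτ
      have hT0 : 0 < T := by linarith
      have h2 : Real.exp (-((τ / δ / 2) ^ 2 / (2 * (4 * N)))) ≤ (1 / T) ^ (4 * (dX + dY) + k) := by
        calc Real.exp (-((τ / δ / 2) ^ 2 / (2 * (4 * N)))) ≤
              Real.exp (-(((4 * (dX + dY) + k : ℕ) : ℝ) * Real.log T)) :=
              Real.exp_le_exp.2 (neg_le_neg h1)
          _ = (1 / T) ^ (4 * (dX + dY) + k) := by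
              rw [Real.exp_neg, Real.exp_nat_mul, Real.exp_log hT0, one_div, inv_pow]
      have h3 : (((32 * (dX + dY) * N ^ 2 : ℕ) : ℝ) + 1) ≤ 64 * (dX + dY) * T ^ 4 := by
        have h4 : (N : ℝ) ^ 2 ≤ T ^ 4 := by
          calc (N : ℝ) ^ 2 ≤ (T ^ 2) ^ 2 := by gcongr; exact hNP.trans hPT
            _ = T ^ 4 := by ring
        have h5 : (1 : ℝ) ≤ ((dX : ℝ) + dY) * N ^ 2 :=
          one_le_mul_of_one_le_of_one_le (by linarith) (one_le_pow₀ hN1)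
        have h6 : ((dX : ℝ) + dY) * N ^ 2 ≤ (dX + dY) * T ^ 4 := by gcongr
        push_cast
        linarith
      calc (((32 * (dX + dY) * N ^ 2 : ℕ) : ℝ) + 1) ^ (dX + dY) *
            (2 * Real.exp (-((τ / δ / 2) ^ 2 / (2 * (4 * N)))))
          ≤ (64 * (dX + dY) * T ^ 4) ^ (dX + dY) * (2 * (1 / T) ^ (4 * (dX + dY) + k)) := by
            gcongr
        _ = 2 * (64 * (dX + dY) : ℝ) ^ (dX + dY) * (1 / T) ^ k *
              (T ^ (4 * (dX + dY)) * (1 / T) ^ (4 * (dX + dY))) := by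
            rw [mul_pow _ (T ^ 4), ← pow_mul, pow_add (1 / T)]; ring
        _ = 2 * (64 * (dX + dY) : ℝ) ^ (dX + dY) * (1 / T) ^ k := by
            rw [← mul_pow, mul_one_div_cancel hT0.ne', one_pow, mul_one]
        _ ≤ 2 * (64 * (dX + dY) : ℝ) ^ (dX + dY) * (1 / 2) ^ k := by gcongr
        _ ≤ η := hk
    · refine le_trans (Real.exp_le_exp.2 ?_) hηκ
      have hN0 : (0 : ℝ) < N := by linarith
      have h1 : ((n : ℝ) * δ ^ 2) ^ 2 * N * N = c ^ 4 * P := by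
        calc ((n : ℝ) * δ ^ 2) ^ 2 * N * N = n ^ 2 * (δ ^ 2 * N) ^ 2 := by ring
          _ = c ^ 4 * (n ^ 2 * R ^ 4) := by rw [hδN]; ring
          _ = c ^ 4 * P := by rw [hR4]
      -- Rounding the two cut-offs down costs at most 2^(dX + dY) in the number of frequencies; c⁴ ≤
      -- c is enough to compensate.
      have h2 : ((n : ℝ) * δ ^ 2) ^ 2 * N ≤ c * 2 ^ (dX + dY) := by
        refine le_of_mul_le_mul_right ?_ hN0
        rw [h1, mul_assoc]
        exact mul_le_mul (pow_le_of_le_one hc0.le hc1 (by norm_num)) hPN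
          (by linarith) hc0.le
      have h3 : 0 ≤ ((n : ℝ) * δ ^ 2) ^ 2 * N := by positivity
      linarith
  -- A radius below cR has risk at least 1 - κ > γ, so it does not compete in the infimum.
  refine le_iInf₂ fun ρ hρ => ?_
  obtain ⟨hρ0, hργ⟩ := hρ
  refine ENNReal.ofReal_le_ofReal (le_of_not_gt fun hlt => ?_)
  have h1 := (hrisk ρ hρ0 hlt.le).trans hργ
  have h2 := (ENNReal.ofReal_le_ofReal_iff hγ0.le).1 h1
  linarith

end Rate

end IndepTest

end

/-- The two conclusions concern the Fourier functions with non-negative frequencies and the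
complete Fourier basis of `L²`; they are the same if `dX = dY = 1`. -/
theorem mainTheorem6 (dX dY : ℕ) (hdX : 1 ≤ dX) (hdY : 1 ≤ dY)
    (sX sY : ℝ) (hsX : 0 < sX) (hsY : 0 < sY) (A : ℝ) (hA : 1 < A)
    (γ : ℝ) (hγ0 : 0 < γ) (hγ1 : γ < 1) :
    ∃ c₁ c₂ : ℝ, 0 < c₁ ∧ 0 < c₂ ∧
      ∀ (n : ℕ) (r : ℝ), 0 < r → 2 ≤ (n : ℝ) * r ^ 2 →
        IndepTest.sobolevRate dX dY sX sY n r ≤ c₁ / √(Real.log ((n : ℝ) * r ^ 2)) →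
        ENNReal.ofReal (c₂ * IndepTest.sobolevRate dX dY sX sY n r) ≤
            IndepTest.sobolevSeparation (IndepTest.nonnegFreq dX) (IndepTest.nonnegFreq dY)
              n γ sX sY r A ∧
          ENNReal.ofReal (c₂ * IndepTest.sobolevRate dX dY sX sY n r) ≤
            IndepTest.sobolevSeparation (IndepTest.halfFreq dX) (IndepTest.halfFreq dY)
              n γ sX sY r A := by
  have hdX1 : (1 : ℝ) ≤ dX := by exact_mod_cast hdX
  -- This gives 1 - κ = (1 + γ)/2 > γ.
  obtain ⟨κ, hκdef⟩ : ∃ κ : ℝ, κ = (1 - γ) / 2 := ⟨_, rfl⟩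
  have hκ : 0 < κ := by linarith
  obtain ⟨τ, hτdef⟩ : ∃ τ : ℝ, τ = min 1 (A - 1) := ⟨_, rfl⟩
  have hτ0 : 0 < τ := by rw [hτdef]; exact lt_min one_pos (by linarith)
  have hτ1 : τ ≤ 1 := by rw [hτdef]; exact min_le_left _ _
  have hτA : 1 + τ ≤ A := by have := min_le_right 1 (A - 1); linarith
  -- At η = 0 the inequality reads 1 < 1 + κ²; continuity leaves room for a small positive η.
  obtain ⟨η, hη0, hη1, hηκ⟩ : ∃ η : ℝ, 0 < η ∧ η < 1 ∧
      Real.exp η ≤ (1 + κ ^ 2) * (1 - η) ^ 2 := by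
    have hcont : Continuous fun x : ℝ => (1 + κ ^ 2) * (1 - x) ^ 2 - Real.exp x := by fun_prop
    have hpos : ∀ᶠ x in nhdsWithin (0 : ℝ) (Set.Ioi 0),
        0 < (1 + κ ^ 2) * (1 - x) ^ 2 - Real.exp x :=
      nhdsWithin_le_nhds (hcont.continuousAt.eventually (lt_mem_nhds (by
        simp only [sub_zero, Real.exp_zero]
        nlinarith)))
    obtain ⟨x, hx, hx0, hx1⟩ := (hpos.and (Ioo_mem_nhdsGT (one_pos : (0 : ℝ) < 1))).exists
    exact ⟨x, hx0, hx1, by linarith⟩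
  obtain ⟨Cθ, hCdef⟩ : ∃ C : ℝ, C = max ((dX : ℝ) ^ sX) ((dY : ℝ) ^ sY) := ⟨_, rfl⟩
  have hCX : (dX : ℝ) ^ sX ≤ Cθ := by rw [hCdef]; exact le_max_left _ _
  have hCY : (dY : ℝ) ^ sY ≤ Cθ := by rw [hCdef]; exact le_max_right _ _
  have hC0 : 0 < Cθ := (Real.rpow_pos_of_pos (by linarith) _).trans_le hCX
  obtain ⟨k, hk⟩ : ∃ k : ℕ, 2 * (64 * (dX + dY) : ℝ) ^ (dX + dY) * (1 / 2) ^ k ≤ η := by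
    have h0 : 0 < 2 * (64 * (dX + dY) : ℝ) ^ (dX + dY) := by positivity
    obtain ⟨k, hk⟩ := exists_pow_lt_of_lt_one (div_pos hη0 h0)
      (by norm_num : (1 / 2 : ℝ) < 1)
    refine ⟨k, ?_⟩
    rw [lt_div_iff₀ h0, mul_comm] at hk
    exact hk.le
  have hE : (1 : ℝ) ≤ 32 * (4 * (dX + dY) + k) := by
    have : (0 : ℝ) ≤ k := Nat.cast_nonneg k
    have : (0 : ℝ) ≤ dY := Nat.cast_nonneg dY
    linarith
  have hE0 : (0 : ℝ) < 32 * (4 * (dX + dY) + k) := by linarith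
  -- The last condition is linear in c: the factor in it is at least 1, so it also gives c ≤ τ, and
  -- the product of the two yields the quadratic bound without a square root.
  obtain ⟨c, hc0, hc1, hcθ, hcη, hcτ⟩ : ∃ c : ℝ, 0 < c ∧ c ≤ 1 ∧ Cθ * c ≤ 1 ∧
      c * 2 ^ (dX + dY) ≤ η ∧ c * (32 * (4 * (dX + dY) + k)) ≤ τ := by
    refine ⟨min (min 1 (1 / Cθ)) (min (η / 2 ^ (dX + dY)) (τ / (32 * (4 * (dX + dY) + k)))),
      by positivity, (min_le_left _ _).trans (min_le_left _ _), ?_, ?_, ?_⟩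
    · rw [mul_comm]
      exact (le_div_iff₀ hC0).1 ((min_le_left _ _).trans (min_le_right _ _))
    · exact (le_div_iff₀ (by positivity)).1 ((min_le_right _ _).trans (min_le_left _ _))
    · exact (le_div_iff₀ hE0).1 ((min_le_right _ _).trans (min_le_right _ _))
  have hcτ' : 32 * c ^ 2 * (4 * (dX + dY) + k) ≤ τ ^ 2 := by
    have h1 : c ≤ τ := (le_mul_of_one_le_right hc0.le hE).trans hcτ
    calc 32 * c ^ 2 * (4 * (dX + dY) + k) = c * (c * (32 * (4 * (dX + dY) + k))) := by ring
      _ ≤ τ * τ := mul_le_mul h1 hcτ (by positivity) hτ0.le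
      _ = τ ^ 2 := (sq τ).symm
  -- c₁ = 1 suffices, since the amplitude of the perturbation is cR and c absorbs the constant of
  -- the logarithmic condition.
  refine ⟨1, c, one_pos, hc0, fun n r hr hT hrate => ⟨?_, ?_⟩⟩
  · exact IndepTest.le_sobolevSeparation hdX hdY subset_rfl subset_rfl
      (fun m hm m' hm' h _ => IndepTest.add_ne_zero_of_mem_nonnegFreq hm hm' h)
      (fun m hm m' hm' h _ => IndepTest.add_ne_zero_of_mem_nonnegFreq hm hm' h)
      hsX hsY hγ0 (by linarith) hκ hτ0 hτ1 hτA hη1 hηκ hCX hCY hk hc0 hc1 hcθ hcη hcτ' hr hT hrate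
  · exact IndepTest.le_sobolevSeparation hdX hdY IndepTest.nonnegFreq_subset_halfFreq
      IndepTest.nonnegFreq_subset_halfFreq
      (fun m hm m' hm' h h' => IndepTest.add_ne_zero_of_mem_halfFreq hm hm' h h')
      (fun m hm m' hm' h h' => IndepTest.add_ne_zero_of_mem_halfFreq hm hm' h h')
      hsX hsY hγ0 (by linarith) hκ hτ0 hτ1 hτA hη1 hηκ hCX hCY hk hc0 hc1 hcθ hcη hcτ' hr hT hrate
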